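/- Let $n_1,n_2>1$ be integers and $n=n_1n_2$. For real $L\ge 1$ let $f=X^n+a_{n-1}X^{n-1}+\dots+a_0$ be a random monic polynomial whose coefficients $a_0,\dots,a_{n-1}$ are chosen independently and uniformly from $[-L,L]\cap\mathbb{Z}$. For a subgroup $G\le S_n$, write $G_f=G$ if $f$ has $n$ distinct complex roots and, for some numbering of these roots by $1,\dots,n$, the Galois group of $f$ over $\mathbb{Q}$, acting on the roots, equals $G$ as a permutation group. Let $G\le S_n$ be transitive, and suppose that there is a partition of $\{1,\dots,n\}$ into $n_1$ blocks (each then of size $n_2$) which are permuted among themselves by $G$, such that the induced action of $G$ on the set of the $n_1$ blocks is primitive. Then for every $\varepsilon>0$ there is a constant $C>0$, depending only on $n_1$, $n_2$ and $\varepsilon$, such that for all real $L\ge 1$ $$\mathrm{Prob}(G_f=G)\le C\,L^{-n+\nu+\varepsilon},$$ where $$\nu=\max\Big\{\tfrac12+\tfrac1{n_1}+n_2,\; n_1+\tfrac{n_2}{n_1},\; n_1+\big(1-\tfrac1{n_1}\big)(n_2-1)\Big\}.$$ -/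

import Mathlib

open scoped Pointwise Polynomial

noncomputable section

/-- The monic integer polynomial `X ^ n + a (n-1) * X ^ (n-1) + ⋯ + a 0`. -/
def monicOfCoeffs {n : ℕ} (a : Fin n → ℤ) : ℤ[X] :=
  Polynomial.X ^ n + ∑ i : Fin n, Polynomial.C (a i) * Polynomial.X ^ (i : ℕ)

/-- The coefficient vectors of the large box model: all coordinates lie in `[-L, L] ∩ ℤ`. -/
def coeffBox (n : ℕ) (L : ℝ) : Finset (Fin n → ℤ) :=
  Fintype.piFinset fun _ => Finset.Icc ⌈-L⌉ ⌊L⌋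

open Classical in
/-- The probability that a random monic integer polynomial of degree `n`, whose `n` lower
coefficients are independent and uniform in `[-L, L] ∩ ℤ`, has the property `P`. -/
def boxProb (n : ℕ) (L : ℝ) (P : ℤ[X] → Prop) : ℝ :=
  (((coeffBox n L).filter fun a => P (monicOfCoeffs a)).card : ℝ) / ((coeffBox n L).card : ℝ)

/-- `f` has `n` distinct complex roots, and for a suitable numbering of them by `Fin n` the
Galois group of `f` over `ℚ`, acting on the roots, is the permutation group `G`. As the numbering
is arbitrary, `G` matters only up to conjugation in the symmetric group. -/
def HasGaloisGroup {n : ℕ} (f : ℤ[X]) (G : Subgroup (Equiv.Perm (Fin n))) : Prop :=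
  haveI : Fact (((f.map (Int.castRingHom ℚ)).map (algebraMap ℚ ℂ)).Splits) :=
    ⟨IsAlgClosed.splits _⟩
  ∃ e : (f.map (Int.castRingHom ℚ)).rootSet ℂ ≃ Fin n,
    ((Polynomial.Gal.galActionHom (f.map (Int.castRingHom ℚ)) ℂ).range).map
      e.permCongrHom.toMonoidHom = G

/-- The sets in `ℬ` form a partition of `{1, …, n}` into `n₁` (nonempty) blocks. That the elements
of `G` permute these blocks is part of `ℬ` being a `SubMulAction`, which also provides the
induced action of `G` on the set of blocks. -/
structure IsSystemOfBlocks {n : ℕ} {G : Subgroup (Equiv.Perm (Fin n))} (n₁ : ℕ)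
    (ℬ : SubMulAction G (Set (Fin n))) : Prop where
  isPartition : Setoid.IsPartition (ℬ : Set (Set (Fin n)))
  ncard_eq : (ℬ : Set (Set (Fin n))).ncard = n₁

/-- `G ≤ S_n` is transitive and preserves a partition into `n₁` blocks (so all blocks have
`n / n₁` elements) such that the induced action of `G` on the set of blocks is primitive. -/
def IsTransitiveImprimitiveWithPrimitiveQuotient {n : ℕ} (n₁ : ℕ)
    (G : Subgroup (Equiv.Perm (Fin n))) : Prop :=
  MulAction.IsPretransitive G (Fin n) ∧
    ∃ ℬ : SubMulAction G (Set (Fin n)),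
      IsSystemOfBlocks n₁ ℬ ∧ MulAction.IsPreprimitive G ℬ

/-- The exponent `ν(n₁, n₂)`. -/
def nuExponent (n₁ n₂ : ℕ) : ℝ :=
  max (1 / 2 + 1 / (n₁ : ℝ) + n₂)
    (max (n₁ + (n₂ : ℝ) / n₁) (n₁ + (1 - 1 / (n₁ : ℝ)) * ((n₂ : ℝ) - 1)))

end

/-! Write `d` for n₁ and `m` for n₂, and let α be a root of f. The fixed field K of a block
stabilizer has degree `d` and lies in ℚ(α). Primitivity on the blocks makes that stabilizer maximal,
so every irrational element of K generates K (`exists_primitive_subfield_of_hasGaloisGroup`).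

The minimal polynomial of α over K has degree `m`, determines f, and has integral coefficients. The
Mahler measures of its conjugates multiply to at most that of f, which is O(L). So its coefficients
lie in one of O((log L)^d) dyadic boxes of conjugates of volume at most B ≍ L, and one of them
generates K (`exists_coefficients_over_subfield`). If N is the largest number of integers of K in
such a box, K contributes, up to logarithms and constants, at most N^m polynomials, and also at most
g·N^(m-1), where g counts the integral generators of K of Mahler measure at most B.

It remains to sum over K. Fields with N ≪ B^(1-1/d) use the second bound: all generators together
number O(B^d), which gives the last entry of ν. If N is larger, a pigeonhole argument yields a
generator of K of Mahler measure O((B/N)^2) (`exists_small_generator_of_lt_ncard`). Hence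
O((B/y)^(2d)) such fields have N ≍ y, and their total y^m (B/y)^(2d) is largest at an end of the
range of y, where it is within B^ν (`pow_mul_div_pow_le`, `le_nuExponent`). -/

/-! ### Counting algebraic integers of bounded Mahler measure -/

open Polynomial in
/-- The algebraic integers of degree `d` whose minimal polynomial has Mahler measure at most `B`. -/
def boundedAlgebraicIntegers (d : ℕ) (B : ℝ) : Set ℂ :=
  {β | IsIntegral ℤ β ∧ (minpoly ℤ β).natDegree = d ∧
    ((minpoly ℤ β).map (Int.castRingHom ℂ)).mahlerMeasure ≤ B}

open Polynomial in
theorem exists_card_monic_mahlerMeasure_le (d : ℕ) (B : ℝ) (hB : 1 ≤ B) :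
    ∃ P : Finset ℤ[X], (P.card : ℝ) ≤ (3 * 2 ^ d * B) ^ d ∧
      ∀ p : ℤ[X], p.Monic → p.natDegree = d →
        (p.map (Int.castRingHom ℂ)).mahlerMeasure ≤ B → p ∈ P := by
  classical
  set T : ℕ := ⌊(2 : ℝ) ^ d * B⌋₊ with hT
  set box : Finset (Fin d → ℤ) := Fintype.piFinset fun _ => Finset.Icc (-(T : ℤ)) T with hbox
  refine ⟨box.image monicOfCoeffs, ?_, ?_⟩
  · have h1 : ((box.image monicOfCoeffs).card : ℝ) ≤ box.card := by
      exact_mod_cast Finset.card_image_le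
    have h2 : (box.card : ℝ) = ((2 * T + 1 : ℕ) : ℝ) ^ d := by
      rw [hbox, Fintype.card_piFinset]
      simp only [Int.card_Icc, Finset.prod_const, Finset.card_univ, Fintype.card_fin]
      rw [show (T : ℤ) + 1 - -T = ((2 * T + 1 : ℕ) : ℤ) by push_cast; ring, Int.toNat_natCast]
      push_cast; ring
    have h3 : (T : ℝ) ≤ 2 ^ d * B := Nat.floor_le (by positivity)
    have h4 : (1 : ℝ) ≤ 2 ^ d * B := by
      have := one_le_pow₀ (one_le_two : (1 : ℝ) ≤ 2) (n := d)
      nlinarith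
    rw [h2] at h1
    refine h1.trans ?_
    gcongr
    push_cast; linarith
  · intro p hp hd hM
    refine Finset.mem_image.2 ⟨fun i => p.coeff i, ?_, ?_⟩
    · refine Fintype.mem_piFinset.2 fun i => ?_
      have h1 := norm_coeff_le_choose_mul_mahlerMeasure i (p.map (Int.castRingHom ℂ))
      rw [coeff_map, natDegree_map_eq_of_injective Int.cast_injective, hd] at h1
      have h2 : ((d.choose i : ℕ) : ℝ) ≤ 2 ^ d := by exact_mod_cast Nat.choose_le_two_pow d i
      have h3 : |(p.coeff i : ℝ)| ≤ 2 ^ d * B := by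
        have : ‖(Int.castRingHom ℂ) (p.coeff i)‖ = |(p.coeff i : ℝ)| := by simp
        rw [← this]
        exact h1.trans (mul_le_mul h2 hM (mahlerMeasure_nonneg _) (by positivity))
      have h4 : (p.coeff i).natAbs ≤ T := Nat.le_floor (by rwa [Nat.cast_natAbs, Int.cast_abs])
      rw [Finset.mem_Icc]; omega
    · have := hp.as_sum
      rw [hd] at this
      rw [monicOfCoeffs]
      conv_rhs => rw [this]
      rw [Finset.sum_range]

open Polynomial in
-- Used twice: to count fields possessing a small generator, and to count the generators of all
-- fields at once.
theorem boundedAlgebraicIntegers_finite_card (d : ℕ) (B : ℝ) (hB : 1 ≤ B) :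
    (boundedAlgebraicIntegers d B).Finite ∧
      ((boundedAlgebraicIntegers d B).ncard : ℝ) ≤ d * (3 * 2 ^ d * B) ^ d := by
  classical
  obtain ⟨P, hP, hmem⟩ := exists_card_monic_mahlerMeasure_le d B hB
  set S : Finset ℂ := (P.filter fun p => p.natDegree = d).biUnion
    fun p => (p.map (Int.castRingHom ℂ)).roots.toFinset with hS
  have hsub : boundedAlgebraicIntegers d B ⊆ S := by
    rintro β ⟨h1, h2, h3⟩
    have hm := minpoly.monic h1
    simp only [hS, Finset.coe_biUnion, Set.mem_iUnion]
    refine ⟨minpoly ℤ β, Finset.mem_coe.2 (Finset.mem_filter.2 ⟨hmem _ hm h2 h3, h2⟩), ?_⟩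
    simp only [Finset.mem_coe, Multiset.mem_toFinset]
    rw [mem_roots (hm.map _).ne_zero, IsRoot.def, eval_map]
    exact minpoly.aeval ℤ β
  refine ⟨S.finite_toSet.subset hsub, ?_⟩
  have h1 : (boundedAlgebraicIntegers d B).ncard ≤ S.card := by
    rw [← Set.ncard_coe_finset]; exact Set.ncard_le_ncard hsub S.finite_toSet
  have h2 : S.card ≤ P.card * d := by
    refine Finset.card_biUnion_le.trans ?_
    refine (Finset.sum_le_card_nsmul _ _ d ?_).trans ?_
    · intro p hp
      refine (Multiset.toFinset_card_le _).trans ((card_roots' _).trans ?_)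
      exact natDegree_map_le.trans (Finset.mem_filter.1 hp).2.le
    · rw [smul_eq_mul]; exact Nat.mul_le_mul_right _ (Finset.card_filter_le _ _)
  calc ((boundedAlgebraicIntegers d B).ncard : ℝ) ≤ P.card * d := by exact_mod_cast h1.trans h2
    _ ≤ (3 * 2 ^ d * B) ^ d * d := by gcongr
    _ = _ := by ring

/-! ### Integers of a number field and their conjugates -/

section NumberFields

open Polynomial IntermediateField

theorem isIntegral_int_coe {K : IntermediateField ℚ ℂ} {b : K} (hb : IsIntegral ℤ b) :
    IsIntegral ℤ (b : ℂ) :=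
  hb.map (K.val.restrictScalars ℤ)

theorem map_minpoly_int_coe {K : IntermediateField ℚ ℂ} {b : K} (hb : IsIntegral ℤ b) :
    (minpoly ℤ (b : ℂ)).map (Int.castRingHom ℂ) = (minpoly ℚ b).map (algebraMap ℚ ℂ) := by
  have h1 := minpoly.isIntegrallyClosed_eq_field_fractions' (R := ℤ) ℚ (isIntegral_int_coe hb)
  have h2 : minpoly ℚ (b : ℂ) = minpoly ℚ b :=
    minpoly.algHom_eq K.val (RingHom.injective _) b
  rw [← h2, h1, Polynomial.map_map]
  congr 1

variable {K : IntermediateField ℚ ℂ} [FiniteDimensional ℚ K]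

theorem one_le_prod_norm_embeddings {b : K} (hb : IsIntegral ℤ b) (h0 : b ≠ 0) :
    1 ≤ ∏ σ : K →ₐ[ℚ] ℂ, ‖σ b‖ := by
  rw [← norm_prod, ← Algebra.norm_eq_prod_embeddings ℚ ℂ b]
  obtain ⟨z, hz⟩ := IsIntegrallyClosed.isIntegral_iff.1 (Algebra.isIntegral_norm ℚ hb)
  rw [← hz]
  have hz0 : z ≠ 0 := by
    rintro rfl
    rw [map_zero] at hz
    exact h0 (Algebra.norm_eq_zero_iff.1 hz.symm)
  simp only [eq_intCast, map_intCast, Complex.norm_intCast]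
  exact_mod_cast Int.one_le_abs hz0

theorem eval_embeddings_injective_of_adjoin_eq_top {b : K} (hb : ℚ⟮b⟯ = ⊤) :
    Function.Injective fun σ : K →ₐ[ℚ] ℂ => σ b := fun σ τ h =>
  (Field.primitive_element_iff_algHom_eq_of_eval ℚ ℂ (fun _ => IsAlgClosed.splits _) b σ).1 hb τ h

theorem natDegree_minpoly_int_coe {b : K} (hb : IsIntegral ℤ b) (hgen : ℚ⟮b⟯ = ⊤) :
    (minpoly ℤ (b : ℂ)).natDegree = Module.finrank ℚ K := by
  have h := congrArg natDegree (map_minpoly_int_coe hb)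
  rw [natDegree_map_eq_of_injective Int.cast_injective, natDegree_map] at h
  rw [h, ← IntermediateField.adjoin.finrank (IsIntegral.of_finite ℚ b), hgen,
    IntermediateField.finrank_top']

/-- The conjugates of a generator are distinct and exhaust the roots of its minimal polynomial. -/
theorem mahlerMeasure_minpoly_int_coe {b : K} (hb : IsIntegral ℤ b) (hgen : ℚ⟮b⟯ = ⊤) :
    ((minpoly ℤ (b : ℂ)).map (Int.castRingHom ℂ)).mahlerMeasure =
      ∏ σ : K →ₐ[ℚ] ℂ, max 1 ‖σ b‖ := by
  classical
  have hint : IsIntegral ℚ b := IsIntegral.of_finite ℚ b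
  rw [map_minpoly_int_coe hb, mahlerMeasure_eq_leadingCoeff_mul_prod_roots,
    ((minpoly.monic hint).map _).leadingCoeff, norm_one, one_mul]
  have hinj := eval_embeddings_injective_of_adjoin_eq_top hgen
  have hnd : ((minpoly ℚ b).map (algebraMap ℚ ℂ)).roots.Nodup :=
    nodup_roots ((minpoly.irreducible hint).separable.map)
  have hroots : ((minpoly ℚ b).map (algebraMap ℚ ℂ)).roots =
      (Finset.univ.val.map fun σ : K →ₐ[ℚ] ℂ => σ b) := by
    symm
    refine Multiset.eq_of_le_of_card_le ?_ ?_
    · refine (Multiset.le_iff_subset (Multiset.Nodup.map hinj Finset.univ.nodup)).2 ?_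
      intro x hx
      obtain ⟨σ, -, rfl⟩ := Multiset.mem_map.1 hx
      rw [mem_roots ((minpoly.monic hint).map _).ne_zero, IsRoot.def, eval_map_algebraMap,
        aeval_algHom_apply, minpoly.aeval, map_zero]
    · rw [Multiset.card_map, Finset.card_val, Finset.card_univ, AlgHom.card]
      refine (card_roots' _).trans ?_
      rw [natDegree_map, ← IntermediateField.adjoin.finrank hint, hgen,
        IntermediateField.finrank_top']
  rw [hroots, Multiset.map_map]
  rfl

theorem coe_mem_boundedAlgebraicIntegers {b : K} (hb : IsIntegral ℤ b) (hgen : ℚ⟮b⟯ = ⊤) {B : ℝ}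
    (hB : ∏ σ : K →ₐ[ℚ] ℂ, max 1 ‖σ b‖ ≤ B) :
    (b : ℂ) ∈ boundedAlgebraicIntegers (Module.finrank ℚ K) B :=
  ⟨isIntegral_int_coe hb, natDegree_minpoly_int_coe hb hgen,
    (mahlerMeasure_minpoly_int_coe hb hgen).trans_le hB⟩

/-- The algebraic integers of `K` all of whose conjugates are bounded by the given radii. -/
def conjBox (K : IntermediateField ℚ ℂ) (r : (K →ₐ[ℚ] ℂ) → ℝ) : Set K :=
  {b | IsIntegral ℤ b ∧ ∀ σ, ‖σ b‖ ≤ r σ}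

theorem conjBox_finite (r : (K →ₐ[ℚ] ℂ) → ℝ) : (conjBox K r).Finite := by
  have : NumberField K := ⟨⟩
  refine (NumberField.Embeddings.finite_of_norm_le K ℂ (∑ σ, |r σ|)).subset ?_
  rintro b ⟨h1, h2⟩
  refine ⟨h1, fun φ => ?_⟩
  have h3 := h2 φ.toRatAlgHom
  refine (h3.trans (le_abs_self _)).trans ?_
  exact Finset.single_le_sum (f := fun σ => |r σ|) (fun σ _ => abs_nonneg _) (Finset.mem_univ _)

end NumberFields

/-! ### Crowded boxes and small generators -/

section Pigeonhole

open Polynomial IntermediateField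

variable {K : IntermediateField ℚ ℂ}

/-- The real number `Re (σ b) + Im (σ b)`. For `σ` running through all embeddings, these
numbers are independent real coordinates of `b`. -/
noncomputable def embeddingCoord (σ : K →ₐ[ℚ] ℂ) (b : K) : ℝ := (σ b).re + (σ b).im

/-- The complex conjugate of an embedding. -/
noncomputable def conjEmbedding (σ : K →ₐ[ℚ] ℂ) : K →ₐ[ℚ] ℂ :=
  (Complex.conjAe.toAlgHom.restrictScalars ℚ).comp σ

theorem conjEmbedding_apply (σ : K →ₐ[ℚ] ℂ) (b : K) :
    conjEmbedding σ b = (starRingEnd ℂ) (σ b) := rfl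

/-- |Re| + |Im| equals |Re + Im| or |Re − Im|, the coordinates at `σ` and at its complex conjugate.
-/
theorem norm_le_max_abs_embeddingCoord (σ : K →ₐ[ℚ] ℂ) (b : K) :
    ‖σ b‖ ≤ max |embeddingCoord σ b| |embeddingCoord (conjEmbedding σ) b| := by
  refine (Complex.norm_le_abs_re_add_abs_im _).trans ?_
  simp only [embeddingCoord, conjEmbedding_apply, Complex.conj_re, Complex.conj_im]
  rcases abs_cases (σ b).re with h | h <;> rcases abs_cases (σ b).im with h' | h' <;>
    rw [h.1, h'.1, le_max_iff]
  · exact Or.inl (le_abs_self _)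
  · exact Or.inr (le_abs_self _)
  · right; refine le_trans (le_of_eq ?_) (neg_le_abs _); ring
  · left; refine le_trans (le_of_eq ?_) (neg_le_abs _); ring

theorem abs_embeddingCoord_le (σ : K →ₐ[ℚ] ℂ) (b : K) : |embeddingCoord σ b| ≤ 2 * ‖σ b‖ := by
  have h1 := Complex.abs_re_le_norm (σ b)
  have h2 := Complex.abs_im_le_norm (σ b)
  have h3 := abs_add_le (σ b).re (σ b).im
  rw [embeddingCoord]; linarith

variable [FiniteDimensional ℚ K]

/-- If a box of conjugates contains many integers, two of them lie in a common small cell. -/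
theorem exists_integer_embeddingCoord_small {r : (K →ₐ[ℚ] ℂ) → ℝ} (hr : ∀ σ, 1 ≤ r σ)
    {σ₀ : K →ₐ[ℚ] ℂ} {V : ℝ} (hV : 0 < V) (hVr : V ≤ r σ₀)
    (hN : (24 : ℝ) ^ Module.finrank ℚ K * (∏ σ, r σ) / V < (conjBox K r).ncard) :
    ∃ b : K, IsIntegral ℤ b ∧ b ≠ 0 ∧ |embeddingCoord σ₀ b| < V ∧
      ∀ σ, σ ≠ σ₀ → |embeddingCoord σ b| < 1 / 4 := by
  classical
  set s : (K →ₐ[ℚ] ℂ) → ℝ := fun σ => if σ = σ₀ then V else 1 / 4 with hs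
  have hs0 : ∀ σ, 0 < s σ := fun σ => by
    simp only [hs]; split_ifs <;> [exact hV; norm_num]
  have hsr : ∀ σ, s σ ≤ r σ := fun σ => by
    simp only [hs]; split_ifs with h
    · exact h ▸ hVr
    · linarith [hr σ]
  set q : (K →ₐ[ℚ] ℂ) → ℝ := fun σ => 2 * r σ / s σ with hq
  have hrs : ∀ σ, 1 ≤ r σ / s σ := fun σ => (one_le_div (hs0 σ)).2 (hsr σ)
  set cells : Finset ((K →ₐ[ℚ] ℂ) → ℤ) := Fintype.piFinset fun σ => Finset.Icc ⌊-q σ⌋ ⌊q σ⌋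
    with hcells
  -- Each axis meets at most 2q + 2 ≤ 6r/s cells, and the sides multiply to at least V/4^d; hence 24
  -- = 6 · 4.
  have hcard : (cells.card : ℝ) ≤ 24 ^ Module.finrank ℚ K * (∏ σ, r σ) / V := by
    have h1 : (cells.card : ℝ) ≤ ∏ σ, 6 * (r σ / s σ) := by
      rw [hcells, Fintype.card_piFinset, Nat.cast_prod]
      refine Finset.prod_le_prod (fun _ _ => by positivity) fun σ _ => ?_
      have hq1 : q σ = 2 * (r σ / s σ) := by rw [hq]; ring
      have hle : ⌊-q σ⌋ ≤ ⌊q σ⌋ + 1 := by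
        have : ⌊-q σ⌋ ≤ ⌊q σ⌋ := Int.floor_le_floor (by linarith [hrs σ])
        omega
      rw [Int.card_Icc]
      have h2 : (((⌊q σ⌋ + 1 - ⌊-q σ⌋).toNat : ℕ) : ℝ) = ⌊q σ⌋ + 1 - ⌊-q σ⌋ := by
        have : (((⌊q σ⌋ + 1 - ⌊-q σ⌋).toNat : ℤ)) = ⌊q σ⌋ + 1 - ⌊-q σ⌋ :=
          Int.toNat_of_nonneg (by omega)
        exact_mod_cast this
      rw [h2]
      have h3 := Int.floor_le (q σ)
      have h4 := Int.lt_floor_add_one (-q σ)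
      linarith [hrs σ]
    have h2 : ∏ σ, 6 * (r σ / s σ) = (∏ σ, 6 * r σ) / ∏ σ, s σ := by
      rw [← Finset.prod_div_distrib]; exact Finset.prod_congr rfl fun σ _ => by ring
    have h3 : V * (1 / 4) ^ Module.finrank ℚ K ≤ ∏ σ, s σ := by
      have : ∏ σ, s σ = V * (1 / 4) ^ (Module.finrank ℚ K - 1) := by
        rw [← Finset.mul_prod_erase _ _ (Finset.mem_univ σ₀)]
        congr 1
        · simp [hs]
        · rw [Finset.prod_congr rfl (g := fun _ => (1 / 4 : ℝ)), Finset.prod_const,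
            Finset.card_erase_of_mem (Finset.mem_univ _), Finset.card_univ, AlgHom.card]
          intro σ hσ
          simp [hs, Finset.ne_of_mem_erase hσ]
      rw [this]
      gcongr ?_ * ?_
      exact pow_le_pow_of_le_one (by norm_num) (by norm_num) (Nat.sub_le _ _)
    have h4 : ∏ σ : K →ₐ[ℚ] ℂ, 6 * r σ = 6 ^ Module.finrank ℚ K * ∏ σ, r σ := by
      rw [Finset.prod_mul_distrib, Finset.prod_const, Finset.card_univ, AlgHom.card]
    have hr0 : 0 ≤ ∏ σ, r σ := Finset.prod_nonneg fun σ _ => by linarith [hr σ]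
    rw [h2, h4] at h1
    refine h1.trans ?_
    calc 6 ^ Module.finrank ℚ K * (∏ σ, r σ) / ∏ σ, s σ
        ≤ 6 ^ Module.finrank ℚ K * (∏ σ, r σ) / (V * (1 / 4) ^ Module.finrank ℚ K) := by
          gcongr
      _ = _ := by
          rw [show (24 : ℝ) = 6 * 4 by norm_num, mul_pow, one_div, inv_pow]
          field_simp
  have hfin : (conjBox K r).Finite := conjBox_finite r
  have hlt : cells.card < hfin.toFinset.card := by
    rw [← Set.ncard_eq_toFinset_card _ hfin]
    exact_mod_cast hcard.trans_lt hN
  obtain ⟨x, hx, y, hy, hxy, hfl⟩ := Finset.exists_ne_map_eq_of_card_lt_of_maps_to hlt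
    (f := fun b σ => ⌊embeddingCoord σ b / s σ⌋) (by
      intro b hb
      have hb' := (hfin.mem_toFinset.1 hb).2
      refine Finset.mem_coe.2 (Fintype.mem_piFinset.2 fun σ => ?_)
      have h1 : |embeddingCoord σ b / s σ| ≤ q σ := by
        rw [abs_div, abs_of_pos (hs0 σ)]
        have := hs0 σ
        change _ ≤ 2 * r σ / s σ
        gcongr
        linarith [abs_embeddingCoord_le σ b, hb' σ]
      rw [abs_le] at h1
      exact Finset.mem_Icc.2 ⟨Int.floor_le_floor h1.1, Int.floor_le_floor h1.2⟩)
  have hx' := hfin.mem_toFinset.1 hx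
  have hy' := hfin.mem_toFinset.1 hy
  have hsmall : ∀ σ, |embeddingCoord σ (x - y)| < s σ := fun σ => by
    have h1 := Int.abs_sub_lt_one_of_floor_eq_floor (congrFun hfl σ)
    rw [← sub_div, abs_div, abs_of_pos (hs0 σ), div_lt_one (hs0 σ)] at h1
    have h2 : embeddingCoord σ (x - y) = embeddingCoord σ x - embeddingCoord σ y := by
      rw [embeddingCoord, map_sub, Complex.sub_re, Complex.sub_im, embeddingCoord, embeddingCoord]
      ring
    rwa [h2]
  refine ⟨x - y, hx'.1.sub hy'.1, sub_ne_zero.2 hxy, ?_, fun σ hσ => ?_⟩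
  · simpa [hs] using hsmall σ₀
  · have := hsmall σ
    simpa only [hs, if_neg hσ] using this

/-- Conjugates away from `σ₀` and its complex conjugate have absolute value below 1, but the norm of
`b` is at least 1, so |σ₀ b| ≥ 1. Thus no other embedding agrees with `σ₀` at `b`, and at most two
factors of the product exceed 1. -/
theorem adjoin_eq_top_of_embeddingCoord_small {b : K} (hb : IsIntegral ℤ b) (h0 : b ≠ 0)
    {σ₀ : K →ₐ[ℚ] ℂ} {V : ℝ} (hV : |embeddingCoord σ₀ b| < V)
    (hsmall : ∀ σ, σ ≠ σ₀ → |embeddingCoord σ b| < 1 / 4) :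
    1 / 4 ≤ V ∧ ℚ⟮b⟯ = ⊤ ∧ ∏ σ : K →ₐ[ℚ] ℂ, max 1 ‖σ b‖ ≤ 16 * V ^ 2 := by
  classical
  have hinv : ∀ σ : K →ₐ[ℚ] ℂ, conjEmbedding (conjEmbedding σ) = σ := fun σ => by
    ext x; simp [conjEmbedding_apply]
  have hother : ∀ σ, σ ≠ σ₀ → σ ≠ conjEmbedding σ₀ → ‖σ b‖ < 1 := fun σ h1 h2 => by
    refine (norm_le_max_abs_embeddingCoord σ b).trans_lt (max_lt ?_ ?_)
    · linarith [hsmall σ h1]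
    · have : conjEmbedding σ ≠ σ₀ := fun h => h2 (by rw [← h, hinv])
      linarith [hsmall _ this]
  have hconj : ‖conjEmbedding σ₀ b‖ = ‖σ₀ b‖ := by
    rw [conjEmbedding_apply, RCLike.norm_conj]
  have hlarge : 1 ≤ ‖σ₀ b‖ := by
    by_contra! hlt
    have hall : ∀ σ : K →ₐ[ℚ] ℂ, ‖σ b‖ < 1 := fun σ => by
      by_cases h1 : σ = σ₀
      · rwa [h1]
      by_cases h2 : σ = conjEmbedding σ₀
      · rwa [h2, hconj]
      exact hother σ h1 h2
    refine absurd (one_le_prod_norm_embeddings hb h0) (not_le.2 ?_)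
    rw [← Finset.mul_prod_erase _ _ (Finset.mem_univ σ₀)]
    refine lt_of_le_of_lt (mul_le_of_le_one_right (norm_nonneg _) ?_) hlt
    exact Finset.prod_le_one (fun _ _ => norm_nonneg _) fun σ _ => (hall σ).le
  have hc0 : |embeddingCoord (conjEmbedding σ₀) b| < max V (1 / 4) := by
    by_cases h : conjEmbedding σ₀ = σ₀
    · rw [h]; exact lt_max_of_lt_left hV
    · exact lt_max_of_lt_right (hsmall _ h)
  have hlt : ‖σ₀ b‖ < max V (1 / 4) :=
    (norm_le_max_abs_embeddingCoord σ₀ b).trans_lt (max_lt (lt_max_of_lt_left hV) hc0)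
  have hV1 : 1 ≤ V := by
    rcases lt_max_iff.1 (hlarge.trans_lt hlt) with h | h
    · exact h.le
    · norm_num at h
  rw [max_eq_left (by linarith)] at hlt
  refine ⟨by linarith, ?_, ?_⟩
  · rw [Field.primitive_element_iff_algHom_eq_of_eval ℚ ℂ (fun _ => IsAlgClosed.splits _) b σ₀]
    intro ψ hψ
    by_contra hne
    -- Agreement with the complex conjugate would make `σ₀ b` real; its coordinate there would then
    -- be both below 1/4 and at least 1 in absolute value.
    by_cases h2 : ψ = conjEmbedding σ₀
    · have him : (σ₀ b).im = 0 := by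
        rw [h2, conjEmbedding_apply] at hψ
        exact Complex.conj_eq_iff_im.1 hψ.symm
      have h3 := hsmall ψ (Ne.symm hne)
      rw [embeddingCoord, ← hψ, him, add_zero] at h3
      have h4 := Complex.norm_le_abs_re_add_abs_im (σ₀ b)
      rw [him, abs_zero, add_zero] at h4
      linarith
    · have := hother ψ (Ne.symm hne) h2
      rw [← hψ] at this
      linarith
  · have hsub : ∏ σ ∈ ({σ₀, conjEmbedding σ₀} : Finset (K →ₐ[ℚ] ℂ)), max 1 ‖σ b‖ =
        ∏ σ : K →ₐ[ℚ] ℂ, max 1 ‖σ b‖ := by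
      refine Finset.prod_subset (Finset.subset_univ _) fun σ _ hσ => ?_
      simp only [Finset.mem_insert, Finset.mem_singleton, not_or] at hσ
      exact max_eq_left (hother σ hσ.1 hσ.2).le
    rw [← hsub]
    have h1 : ∏ σ ∈ ({σ₀, conjEmbedding σ₀} : Finset (K →ₐ[ℚ] ℂ)), max 1 ‖σ b‖ ≤
        ∏ σ ∈ ({σ₀, conjEmbedding σ₀} : Finset (K →ₐ[ℚ] ℂ)), V := by
      refine Finset.prod_le_prod (fun _ _ => by positivity) fun σ hσ => ?_
      simp only [Finset.mem_insert, Finset.mem_singleton] at hσ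
      rcases hσ with rfl | rfl
      · exact max_le hV1 hlt.le
      · rw [hconj]; exact max_le hV1 hlt.le
    rw [Finset.prod_const] at h1
    have h2 := pow_le_pow_right₀ hV1
      (Finset.card_le_two : ({σ₀, conjEmbedding σ₀} : Finset (K →ₐ[ℚ] ℂ)).card ≤ 2)
    nlinarith

/-- A box of conjugates containing many integers forces `K` to have a small integral generator. -/
theorem exists_small_generator_of_lt_ncard {r : (K →ₐ[ℚ] ℂ) → ℝ} (hr : ∀ σ, 1 ≤ r σ) {B : ℝ}
    (hrB : ∏ σ, r σ ≤ B)
    (hN : 2 * (24 : ℝ) ^ Module.finrank ℚ K * B ^ (1 - 1 / (Module.finrank ℚ K : ℝ)) <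
      (conjBox K r).ncard) :
    ((conjBox K r).ncard : ℝ) ≤ 8 * 24 ^ Module.finrank ℚ K * B ∧
    ∃ b : K, IsIntegral ℤ b ∧ ℚ⟮b⟯ = ⊤ ∧ ∏ σ : K →ₐ[ℚ] ℂ, max 1 ‖σ b‖ ≤
      16 * (2 * 24 ^ Module.finrank ℚ K * B / (conjBox K r).ncard) ^ 2 := by
  classical
  set d := Module.finrank ℚ K with hd
  have hd0 : 0 < d := Module.finrank_pos
  set N := ((conjBox K r).ncard : ℝ) with hNdef
  set X := ∏ σ, r σ with hX
  have hX1 : 1 ≤ X := by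
    rw [hX]
    exact Finset.one_le_prod fun σ _ => hr σ
  have hB0 : 0 ≤ B := by linarith
  have hcardpos : 0 < Fintype.card (K →ₐ[ℚ] ℂ) := by rw [AlgHom.card]; exact hd0
  have : Nonempty (K →ₐ[ℚ] ℂ) := Fintype.card_pos_iff.1 hcardpos
  -- The largest radius is at least the `d`-th root of the volume, so the long side `V` of the cells
  -- fits there.
  obtain ⟨σ₀, hσ₀⟩ := Finite.exists_max r
  have hr0 : 1 ≤ r σ₀ := hr σ₀
  have hXr : X ≤ r σ₀ ^ d := by
    rw [hX, hd, ← AlgHom.card ℚ K ℂ, ← Finset.card_univ, ← Finset.prod_const]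
    exact Finset.prod_le_prod (fun σ _ => by linarith [hr σ]) fun σ _ => hσ₀ σ
  have hdR : (0 : ℝ) < d := by exact_mod_cast hd0
  have hroot : X ^ (1 / (d : ℝ)) ≤ r σ₀ := by
    calc X ^ (1 / (d : ℝ)) ≤ (r σ₀ ^ d) ^ (1 / (d : ℝ)) := by gcongr
      _ = r σ₀ := by
        rw [← Real.rpow_natCast, ← Real.rpow_mul (by linarith), mul_one_div_cancel hdR.ne',
          Real.rpow_one]
  have hexp : 0 ≤ 1 - 1 / (d : ℝ) := by
    rw [sub_nonneg, div_le_one hdR]; exact_mod_cast hd0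
  have hXsplit : X = X ^ (1 - 1 / (d : ℝ)) * X ^ (1 / (d : ℝ)) := by
    rw [← Real.rpow_add (by linarith)]; simp
  have hN0 : 0 < N := lt_of_le_of_lt (by positivity) hN
  have hA : (0 : ℝ) < 2 * 24 ^ d := by positivity
  -- This makes the cell bound 24^d X / V equal to N/2, below the number of points.
  set V := 2 * 24 ^ d * X / N with hVdef
  have hV0 : 0 < V := by positivity
  have hVr : V ≤ r σ₀ := by
    rw [hVdef, div_le_iff₀ hN0]
    calc 2 * 24 ^ d * X = 2 * 24 ^ d * X ^ (1 - 1 / (d : ℝ)) * X ^ (1 / (d : ℝ)) := by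
          rw [mul_assoc (2 * 24 ^ d : ℝ), ← hXsplit]
      _ ≤ N * r σ₀ := by
          refine mul_le_mul (le_trans ?_ hN.le) hroot (by positivity) hN0.le
          gcongr
      _ = _ := mul_comm _ _
  have hlt : (24 : ℝ) ^ d * X / V < N := by
    rw [hVdef, div_div_eq_mul_div, div_lt_iff₀ (by positivity)]
    have : 0 < 24 ^ d * X * N := by positivity
    nlinarith
  obtain ⟨b, hb, hb0, hb1, hb2⟩ := exists_integer_embeddingCoord_small hr hV0 hVr hlt
  obtain ⟨h1, h2, h3⟩ := adjoin_eq_top_of_embeddingCoord_small hb hb0 hb1 hb2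
  refine ⟨?_, b, hb, h2, h3.trans ?_⟩
  · rw [hVdef, le_div_iff₀ hN0] at h1
    have : 2 * 24 ^ d * X ≤ 2 * 24 ^ d * B := by gcongr
    linarith
  · rw [hVdef]; gcongr

end Pigeonhole

/-! ### From block systems to subfields -/

section GaloisGroups

open Polynomial IntermediateField

theorem adjoin_eq_fixedField_of_isCoatom {F E : Type*} [Field F] [Field E] [Algebra F E]
    [FiniteDimensional F E] [IsGalois F E] {H : Subgroup Gal(E/F)} (hH : IsCoatom H) {b : E}
    (hb : b ∈ fixedField H) (hb' : b ∉ (⊥ : IntermediateField F E)) : F⟮b⟯ = fixedField H := by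
  have hle : F⟮b⟯ ≤ fixedField H := adjoin_simple_le_iff.2 hb
  have h1 : H ≤ F⟮b⟯.fixingSubgroup := (IntermediateField.le_iff_le H F⟮b⟯).1 hle
  rcases hH.le_iff.1 h1 with h2 | h2
  · exfalso
    apply hb'
    have h3 : F⟮b⟯ = ⊥ := by
      rw [← IsGalois.fixedField_fixingSubgroup F⟮b⟯, h2, ← IntermediateField.fixingSubgroup_bot,
        IsGalois.fixedField_fixingSubgroup]
    exact h3 ▸ mem_adjoin_simple_self F b
  · rw [← h2, IsGalois.fixedField_fixingSubgroup]

/-- The field is the image in `Ω` of the fixed field of `S` inside the splitting field. It lies in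
F(x) because `S` contains the stabilizer of `x`, and maximality of `S` excludes intermediate fields.
-/
theorem exists_subfield_of_isCoatom {F Ω : Type*} [Field F] [Field Ω] [Algebra F Ω]
    {p : F[X]} (hp : p.Separable) [Fact ((p.map (algebraMap F Ω)).Splits)] (x : p.rootSet Ω)
    {S : Subgroup p.Gal} (hS : IsCoatom S) (hstab : ∀ γ : p.Gal, γ • x = x → γ ∈ S) :
    ∃ K : IntermediateField F Ω, Module.finrank F K = S.index ∧ K ≤ F⟮(x : Ω)⟯ ∧
      ∀ b ∈ K, b ∉ (⊥ : IntermediateField F Ω) → F⟮b⟯ = K := by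
  set Γ : Subgroup Gal(p.SplittingField/F) := S with hΓ
  have hcoatom : IsCoatom Γ := hS
  have hgal : IsGalois F p.SplittingField := IsGalois.of_separable_splitting_field hp
  set ι := IsScalarTower.toAlgHom F p.SplittingField Ω with hι
  set x' := (Gal.rootsEquivRoots p Ω).symm x with hx'
  have hιx : ι (x' : p.SplittingField) = x :=
    congrArg Subtype.val ((Gal.rootsEquivRoots p Ω).apply_symm_apply x)
  have hfix : F⟮(x' : p.SplittingField)⟯.fixingSubgroup ≤ Γ := by
    intro γ hγ
    have h1 : γ (x' : p.SplittingField) = x' :=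
      (mem_fixingSubgroup_iff _ γ).1 hγ x' (mem_adjoin_simple_self F _)
    refine hstab γ (Subtype.ext ?_)
    change ι (γ (x' : p.SplittingField)) = x
    rw [h1, hιx]
  set K' := fixedField Γ with hK'
  refine ⟨K'.map ι, ?_, ?_, ?_⟩
  · rw [← (K'.equivMap ι).toLinearEquiv.finrank_eq, finrank_eq_fixingSubgroup_index,
      fixingSubgroup_fixedField]
    rfl
  · have h1 : K' ≤ F⟮(x' : p.SplittingField)⟯ := by
      rw [← IsGalois.fixedField_fixingSubgroup F⟮(x' : p.SplittingField)⟯]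
      exact fixedField_antitone hfix
    have h2 := IntermediateField.map_mono ι h1
    rwa [adjoin_map, Set.image_singleton, hιx] at h2
  · rintro _ ⟨b, hb, rfl⟩ hbot
    have h1 : F⟮b⟯ = K' := by
      refine adjoin_eq_fixedField_of_isCoatom hcoatom hb fun hb' => hbot ?_
      rw [IntermediateField.mem_bot] at hb' ⊢
      obtain ⟨q, rfl⟩ := hb'
      exact ⟨q, (ι.commutes q).symm⟩
    rw [← h1, adjoin_map, Set.image_singleton]
    rfl

/-- Transitivity makes every root of `p` a root of the minimal polynomial of `x`, and there are deg
p distinct ones. -/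
theorem minpoly_eq_of_card_rootSet_eq {p : ℚ[X]} (hp : p.Monic)
    [Fact ((p.map (algebraMap ℚ ℂ)).Splits)] (hcard : Nat.card (p.rootSet ℂ) = p.natDegree)
    (x : p.rootSet ℂ) (htrans : ∀ y : p.rootSet ℂ, ∃ γ : p.Gal, γ • x = y) :
    minpoly ℚ (x : ℂ) = p := by
  classical
  have hx : aeval (x : ℂ) p = 0 := (mem_rootSet.1 x.2).2
  have hint : IsIntegral ℚ (x : ℂ) := ⟨p, hp, hx⟩
  have hdvd : minpoly ℚ (x : ℂ) ∣ p := minpoly.dvd ℚ _ hx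
  have hsub : p.rootSet ℂ ⊆ (minpoly ℚ (x : ℂ)).rootSet ℂ := by
    intro y hy
    obtain ⟨γ, hγ⟩ := htrans ⟨y, hy⟩
    set x' := (Gal.rootsEquivRoots p ℂ).symm x with hx'
    set ι := IsScalarTower.toAlgHom ℚ p.SplittingField ℂ with hι
    have h1 : ι (x' : p.SplittingField) = x :=
      congrArg Subtype.val ((Gal.rootsEquivRoots p ℂ).apply_symm_apply x)
    have h2 : ι (γ (x' : p.SplittingField)) = y := congrArg Subtype.val hγ
    refine mem_rootSet.2 ⟨minpoly.ne_zero hint, ?_⟩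
    rw [← h2, aeval_algHom_apply, aeval_algHom_apply, ← h1, minpoly.algHom_eq ι ι.injective,
      minpoly.aeval, map_zero, map_zero]
  refine (eq_of_monic_of_dvd_of_natDegree_le (minpoly.monic hint) hp hdvd ?_).symm
  rw [← hcard, Nat.card_coe_set_eq]
  refine (Set.ncard_le_ncard hsub (Set.toFinite _)).trans ?_
  rw [rootSet_def, Set.ncard_coe_finset]
  refine (Multiset.toFinset_card_le _).trans ((card_roots' _).trans ?_)
  rw [natDegree_map]

theorem degree_sum_coeffs_lt {n : ℕ} (a : Fin n → ℤ) :
    (∑ i : Fin n, C (a i) * X ^ (i : ℕ)).degree < (n : WithBot ℕ) := by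
  refine (degree_sum_le _ _).trans_lt ((Finset.sup_lt_iff (WithBot.bot_lt_coe n)).2 fun i _ => ?_)
  exact (degree_C_mul_X_pow_le _ _).trans_lt (WithBot.coe_lt_coe.2 i.2)

theorem monicOfCoeffs_monic {n : ℕ} (a : Fin n → ℤ) : (monicOfCoeffs a).Monic :=
  monic_X_pow_add (degree_sum_coeffs_lt a)

theorem natDegree_monicOfCoeffs {n : ℕ} (a : Fin n → ℤ) : (monicOfCoeffs a).natDegree = n := by
  rw [monicOfCoeffs, natDegree_eq_of_degree_eq_some]
  rw [degree_add_eq_left_of_degree_lt (by rw [degree_X_pow]; exact degree_sum_coeffs_lt a),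
    degree_X_pow]

theorem coeff_monicOfCoeffs {n : ℕ} (a : Fin n → ℤ) (j : Fin n) :
    (monicOfCoeffs a).coeff j = a j := by
  rw [monicOfCoeffs, coeff_add, coeff_X_pow, if_neg (by have := j.2; omega), zero_add,
    finsetSum_coeff]
  simp only [coeff_C_mul, coeff_X_pow, mul_ite, mul_one, mul_zero]
  rw [Finset.sum_eq_single j]
  · simp
  · intro i _ hij
    rw [if_neg fun h => hij (Fin.ext h.symm)]
  · simp

theorem exists_primitive_subfield_of_hasGaloisGroup {n n₁ : ℕ} (hn : 0 < n) (hn₁ : 1 < n₁)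
    {a : Fin n → ℤ} {G : Subgroup (Equiv.Perm (Fin n))}
    (hG : IsTransitiveImprimitiveWithPrimitiveQuotient n₁ G)
    (h : HasGaloisGroup (monicOfCoeffs a) G) :
    ∃ (α : ℂ) (K : IntermediateField ℚ ℂ),
      minpoly ℚ α = (monicOfCoeffs a).map (Int.castRingHom ℚ) ∧ Module.finrank ℚ K = n₁ ∧
      K ≤ ℚ⟮α⟯ ∧ ∀ b ∈ K, b ∉ (⊥ : IntermediateField ℚ ℂ) → ℚ⟮b⟯ = K := by
  obtain ⟨htrans, ℬ, hℬ, hprim⟩ := hG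
  set p := (monicOfCoeffs a).map (Int.castRingHom ℚ) with hp
  have hpm : p.Monic := (monicOfCoeffs_monic a).map _
  have hpd : p.natDegree = n := by
    rw [hp, natDegree_map_eq_of_injective Int.cast_injective, natDegree_monicOfCoeffs]
  have : Fact ((p.map (algebraMap ℚ ℂ)).Splits) := ⟨IsAlgClosed.splits _⟩
  obtain ⟨e, he⟩ := h
  set φ : p.Gal →* Equiv.Perm (Fin n) :=
    e.permCongrHom.toMonoidHom.comp (Gal.galActionHom p ℂ) with hφ
  have hrange : φ.range = G := by rw [hφ, MonoidHom.range_comp]; exact he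
  have hφe : ∀ γ x, φ γ (e x) = e (γ • x) := fun γ x => by
    change e ((Gal.galActionHom p ℂ γ) (e.symm (e x))) = _
    rw [e.symm_apply_apply]; rfl
  set ψ : p.Gal →* G := φ.codRestrict G fun γ => hrange ▸ ⟨γ, rfl⟩ with hψ
  have hψsurj : Function.Surjective ψ := by
    rintro ⟨g, hg⟩
    rw [← hrange] at hg
    obtain ⟨γ, rfl⟩ := hg
    exact ⟨γ, rfl⟩
  set x : p.rootSet ℂ := e.symm ⟨0, hn⟩ with hx
  have htr : ∀ y : p.rootSet ℂ, ∃ γ : p.Gal, γ • x = y := fun y => by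
    obtain ⟨g, hg⟩ := htrans.exists_smul_eq (e x) (e y)
    obtain ⟨γ, rfl⟩ := hψsurj g
    refine ⟨γ, e.injective ?_⟩
    rw [← hφe]; exact hg
  have hmin := minpoly_eq_of_card_rootSet_eq hpm
    (by rw [Nat.card_congr e, Nat.card_fin, hpd]) x htr
  obtain ⟨B, ⟨hB, hxB⟩, -⟩ := hℬ.isPartition.2 (e x)
  set β : ℬ := ⟨B, hB⟩ with hβ
  have hcardℬ : Nat.card ℬ = n₁ := hℬ.ncard_eq
  have hnt : Nontrivial ℬ := by
    have : Finite ℬ := Nat.finite_of_card_ne_zero (by omega)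
    exact Finite.one_lt_card_iff_nontrivial.1 (by omega)
  have hindex : ((MulAction.stabilizer G β).comap ψ).index = n₁ := by
    rw [Subgroup.index_comap_of_surjective _ hψsurj, MulAction.index_stabilizer_of_transitive,
      hcardℬ]
  have hirr : Irreducible p := by
    rw [← hmin]; exact minpoly.irreducible ⟨p, hpm, (mem_rootSet.1 x.2).2⟩
  obtain ⟨K, hK1, hK2⟩ := exists_subfield_of_isCoatom hirr.separable x
    (Subgroup.isCoatom_comap_of_surjective hψsurj
      (MulAction.IsPreprimitive.isCoatom_stabilizer_of_isPreprimitive G β)) fun γ hγ => by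
    -- An automorphism fixing `x` sends the block of `x` to a block that meets it, hence to itself.
    refine MulAction.mem_stabilizer_iff.2 (Subtype.ext ?_)
    have h4 : e x ∈ ψ γ • B :=
      Set.mem_smul_set.2 ⟨e x, hxB, (hφe γ x).trans (congrArg e hγ)⟩
    exact (hℬ.isPartition.2 (e x)).unique ⟨(ψ γ • β).2, h4⟩ ⟨hB, hxB⟩
  exact ⟨x, K, hmin, hK1.trans hindex, hK2⟩

end GaloisGroups

/-! ### The minimal polynomial over the subfield and its conjugates -/

section RelativeMinpoly

open Polynomial IntermediateField

theorem isIntegral_coeff_minpoly (K : IntermediateField ℚ ℂ) {α : ℂ} (hα : IsIntegral ℤ α)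
    (i : ℕ) : IsIntegral ℤ ((minpoly K α).coeff i) := by
  refine isIntegral_coeff_of_dvd (minpoly ℤ α) (minpoly K α) (minpoly.monic hα)
    (minpoly.monic hα.tower_top) (minpoly.dvd K α ?_) i
  rw [aeval_map_algebraMap, minpoly.aeval]

theorem finrank_mul_natDegree_minpoly {F E : Type*} [Field F] [Field E] [Algebra F E]
    {K : IntermediateField F E} {α : E} (hα : IsIntegral F α) (hK : K ≤ F⟮α⟯) :
    Module.finrank F K * (minpoly K α).natDegree = (minpoly F α).natDegree := by
  have h1 : (K⟮α⟯).restrictScalars F = F⟮α⟯ := by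
    rw [restrictScalars_adjoin]
    refine le_antisymm (adjoin_le_iff.2 (Set.union_subset hK ?_)) (adjoin.mono _ _ _ ?_)
    · exact Set.singleton_subset_iff.2 (mem_adjoin_simple_self F α)
    · exact Set.subset_union_right
  rw [← adjoin.finrank hα, ← adjoin.finrank (hα.tower_top : IsIntegral K α),
    Module.finrank_mul_finrank F K K⟮α⟯, ← h1]
  rfl

theorem adjoin_eq_top_of_adjoin_coe_eq {F E : Type*} [Field F] [Field E] [Algebra F E]
    {K : IntermediateField F E} {b : K} (h : F⟮(b : E)⟯ = K) : F⟮b⟯ = ⊤ := by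
  refine IntermediateField.map_injective K.val ?_
  rw [adjoin_map, Set.image_singleton, ← AlgHom.fieldRange_eq_map, fieldRange_val]
  exact h

theorem adjoin_rat_eq_top_of_adjoin_coe_eq {K : IntermediateField ℚ ℂ} {b : K}
    (h : ℚ⟮(b : ℂ)⟯ = K) : ℚ⟮b⟯ = ⊤ := by
  have h1 := adjoin_eq_top_of_adjoin_coe_eq h
  -- The `ℚ`-algebra structure of `K` as an intermediate field agrees with the one it has as a
  -- division ring.
  have h2 : K.algebra' = (DivisionRing.toRatAlgebra : Algebra ℚ K) := Subsingleton.elim _ _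
  rw [h2] at h1
  exact h1

variable {K : IntermediateField ℚ ℂ} [FiniteDimensional ℚ K]

omit [FiniteDimensional ℚ K] in
-- Each `c` in `K` is P(α) with P rational, so `minpoly K α` divides P − c. Applying an embedding
-- and evaluating at `β` shows that it sends `c` to P(β).
theorem embedding_eq_of_common_root {α : ℂ} (hα : IsIntegral ℚ α) (hK : K ≤ ℚ⟮α⟯)
    {σ τ : K →ₐ[ℚ] ℂ} {β : ℂ} (hσ : eval β ((minpoly K α).map (σ : K →+* ℂ)) = 0)
    (hτ : eval β ((minpoly K α).map (τ : K →+* ℂ)) = 0) : σ = τ := by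
  ext c
  obtain ⟨P, hP⟩ : ∃ P : ℚ[X], aeval α P = (c : ℂ) := by
    have h1 := hK c.2
    rw [← mem_toSubalgebra, adjoin_simple_toSubalgebra_of_isAlgebraic hα.isAlgebraic,
      Algebra.adjoin_singleton_eq_range_aeval] at h1
    exact h1
  have hdvd : minpoly K α ∣ P.map (algebraMap ℚ K) - C c := by
    refine minpoly.dvd K α ?_
    rw [map_sub, aeval_map_algebraMap, hP, aeval_C]
    exact sub_self _
  have key : ∀ ρ : K →ₐ[ℚ] ℂ, eval β ((minpoly K α).map (ρ : K →+* ℂ)) = 0 →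
      ρ c = aeval β P := fun ρ hρ => by
    have h1 := eval_dvd (x := β) (Polynomial.map_dvd (ρ : K →+* ℂ) hdvd)
    rw [hρ, zero_dvd_iff, Polynomial.map_sub, eval_sub, map_C, eval_C, Polynomial.map_map, sub_eq_zero] at h1
    rw [aeval_def, ← eval_map]
    refine h1.symm.trans ?_
    congr 2
    exact ρ.comp_algebraMap
  rw [key σ hσ, key τ hτ]

theorem prod_map_minpoly_dvd {α : ℂ} (hα : IsIntegral ℚ α) (hK : K ≤ ℚ⟮α⟯) :
    ∏ σ : K →ₐ[ℚ] ℂ, (minpoly K α).map (σ : K →+* ℂ) ∣ (minpoly ℚ α).map (algebraMap ℚ ℂ) := by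
  refine Finset.prod_dvd_of_coprime ?_ fun σ _ => ?_
  · intro σ _ τ _ hne
    have h0 : ∀ ρ : K →ₐ[ℚ] ℂ, (minpoly K α).map (ρ : K →+* ℂ) ≠ 0 := fun ρ =>
      ((minpoly.monic hα.tower_top).map _).ne_zero
    by_contra hcop
    rw [Function.onFun, isCoprime_iff_aeval_ne_zero_of_isAlgClosed ℂ ℂ] at hcop
    push Not at hcop
    obtain ⟨β, h1, h2⟩ := hcop
    exact hne (embedding_eq_of_common_root hα hK (β := β) (by simpa using h1) (by simpa using h2))
  · have h1 := Polynomial.map_dvd (σ : K →+* ℂ) (minpoly.dvd_map_of_isScalarTower ℚ K α)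
    rw [Polynomial.map_map] at h1
    have h2 : algebraMap ℚ ℂ = (σ : K →+* ℂ).comp (algebraMap ℚ K) := σ.comp_algebraMap.symm
    rw [h2]
    exact h1

/-- The conjugate factors are pairwise coprime divisors; the cofactor is monic, so its Mahler
measure is at least 1. -/
theorem prod_mahlerMeasure_map_minpoly_le {α : ℂ} (hα : IsIntegral ℚ α) (hK : K ≤ ℚ⟮α⟯) :
    ∏ σ : K →ₐ[ℚ] ℂ, ((minpoly K α).map (σ : K →+* ℂ)).mahlerMeasure ≤
      ((minpoly ℚ α).map (algebraMap ℚ ℂ)).mahlerMeasure := by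
  have hm : (∏ σ : K →ₐ[ℚ] ℂ, (minpoly K α).map (σ : K →+* ℂ)).Monic :=
    monic_prod_of_monic _ _ fun σ _ => (minpoly.monic hα.tower_top).map _
  obtain ⟨h, hh⟩ := prod_map_minpoly_dvd hα hK
  have hmh : h.Monic := hm.of_mul_monic_left (hh ▸ (minpoly.monic hα).map _)
  have h1 : ∏ σ : K →ₐ[ℚ] ℂ, ((minpoly K α).map (σ : K →+* ℂ)).mahlerMeasure =
      (∏ σ : K →ₐ[ℚ] ℂ, (minpoly K α).map (σ : K →+* ℂ)).mahlerMeasure := by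
    have := prod_mahlerMeasure_eq_mahlerMeasure_prod
      (Finset.univ.val.map fun σ : K →ₐ[ℚ] ℂ => (minpoly K α).map (σ : K →+* ℂ))
    rw [Multiset.map_map] at this
    exact this.symm
  rw [h1, hh, mahlerMeasure_mul]
  refine le_mul_of_one_le_right (mahlerMeasure_nonneg _) ?_
  exact one_le_mahlerMeasure_of_one_le_norm_leadingCoeff (by rw [hmh.leadingCoeff, norm_one])

omit [FiniteDimensional ℚ K] in
-- Otherwise α would be a root of a nonzero rational polynomial of too small degree.
theorem exists_coeff_minpoly_notMem_bot {α : ℂ} (hα : IsIntegral ℚ α)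
    (hdeg : (minpoly K α).natDegree < (minpoly ℚ α).natDegree) :
    ∃ i < (minpoly K α).natDegree,
      ((minpoly K α).coeff i : ℂ) ∉ (⊥ : IntermediateField ℚ ℂ) := by
  by_contra! hcon
  have hmon : (minpoly K α).Monic := minpoly.monic hα.tower_top
  have hall : ∀ i, ∃ q : ℚ, algebraMap ℚ K q = (minpoly K α).coeff i := by
    intro i
    rcases lt_trichotomy i (minpoly K α).natDegree with hi | rfl | hi
    · obtain ⟨q, hq⟩ := IntermediateField.mem_bot.1 (hcon i hi)
      exact ⟨q, Subtype.ext hq⟩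
    · exact ⟨1, by rw [map_one, hmon.coeff_natDegree]⟩
    · exact ⟨0, by rw [map_zero, coeff_eq_zero_of_natDegree_lt hi]⟩
  obtain ⟨q, hq⟩ := (mem_lifts _).1 ((lifts_iff_coeff_lifts _).2 hall)
  have hqm : q ≠ 0 := by
    rintro rfl
    rw [Polynomial.map_zero] at hq
    exact hmon.ne_zero hq.symm
  have h0 : aeval α q = 0 := by
    rw [← aeval_map_algebraMap K, hq, minpoly.aeval]
  have h1 := natDegree_le_of_dvd (minpoly.dvd ℚ α h0) hqm
  rw [← hq, natDegree_map] at hdeg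
  omega

omit [FiniteDimensional ℚ K] in
theorem minpoly_rat_eq_of_minpoly_eq {α β : ℂ} (hα : IsIntegral ℚ α)
    (h : minpoly K α = minpoly K β) : minpoly ℚ α = minpoly ℚ β := by
  have h1 : aeval β (minpoly ℚ α) = 0 := by
    rw [← aeval_map_algebraMap K]
    obtain ⟨q, hq⟩ := minpoly.dvd_map_of_isScalarTower ℚ K α
    rw [hq, map_mul, h, minpoly.aeval, zero_mul]
  exact minpoly.eq_of_irreducible_of_monic (minpoly.irreducible hα) h1 (minpoly.monic hα)

end RelativeMinpoly

/-! ### Polynomials attached to one subfield -/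

section FixedSubfield

open Polynomial IntermediateField

theorem card_le_of_forall_exists_box {X Y T : Type*} {m : ℕ} {A : Finset X} {c : X → Fin m → Y}
    (hc : Set.InjOn c A) {labels : Finset T} {S : T → Fin m → Finset Y} {N : ℕ}
    (h : ∀ a ∈ A, ∃ t ∈ labels, ∀ i, c a i ∈ S t i)
    (hN : ∀ t ∈ labels, ∏ i, (S t i).card ≤ N) : A.card ≤ labels.card * N := by
  classical
  rw [← Finset.card_image_of_injOn hc]
  have hsub : A.image c ⊆ labels.biUnion fun t => Fintype.piFinset (S t) := by
    intro y hy
    obtain ⟨a, ha, rfl⟩ := Finset.mem_image.1 hy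
    obtain ⟨t, ht, hi⟩ := h a ha
    exact Finset.mem_biUnion.2 ⟨t, ht, Fintype.mem_piFinset.2 hi⟩
  refine (Finset.card_le_card hsub).trans (Finset.card_biUnion_le.trans ?_)
  rw [← smul_eq_mul]
  refine Finset.sum_le_card_nsmul _ _ _ fun t ht => ?_
  rw [Fintype.card_piFinset]
  exact hN t ht

variable (K : IntermediateField ℚ ℂ) [FiniteDimensional ℚ K]

/-- The exponents of the dyadic radii whose product is at most `B`. -/
noncomputable def dyadicExponents (B : ℝ) : Finset ((K →ₐ[ℚ] ℂ) → ℕ) := by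
  classical
  exact (Fintype.piFinset fun _ => Finset.range (Nat.log 2 ⌊B⌋₊ + 1)).filter
    fun k => ∏ σ, (2 : ℝ) ^ k σ ≤ B

/-- The largest number of algebraic integers in a dyadic box of volume at most `B`. -/
noncomputable def maxBoxCard (B : ℝ) : ℕ :=
  (dyadicExponents K B).sup fun k => (conjBox K fun σ => 2 ^ k σ).ncard

/-- The integral generators of `K` of Mahler measure at most `B`. -/
def boundedGenerators (B : ℝ) : Set K :=
  {b | IsIntegral ℤ b ∧ ℚ⟮b⟯ = ⊤ ∧ ∏ σ : K →ₐ[ℚ] ℂ, max 1 ‖σ b‖ ≤ B}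

variable {K}

theorem mem_dyadicExponents {B : ℝ} {k : (K →ₐ[ℚ] ℂ) → ℕ} :
    k ∈ dyadicExponents K B ↔ ∏ σ, (2 : ℝ) ^ k σ ≤ B := by
  classical
  simp only [dyadicExponents, Finset.mem_filter, and_iff_right_iff_imp, Fintype.mem_piFinset,
    Finset.mem_range]
  intro h σ
  have h1 : (2 : ℝ) ^ k σ ≤ ∏ τ, (2 : ℝ) ^ k τ := by
    rw [← Finset.mul_prod_erase _ _ (Finset.mem_univ σ)]
    exact le_mul_of_one_le_right (by positivity)
      (Finset.one_le_prod fun τ _ => one_le_pow₀ one_le_two)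
  have h2 : 2 ^ k σ ≤ ⌊B⌋₊ := Nat.le_floor (by push_cast; exact h1.trans h)
  exact Nat.lt_succ_of_le (Nat.le_log_of_pow_le one_lt_two h2)

theorem card_dyadicExponents_le (B : ℝ) :
    (dyadicExponents K B).card ≤ (Nat.log 2 ⌊B⌋₊ + 1) ^ Module.finrank ℚ K := by
  classical
  refine (Finset.card_filter_le _ _).trans ?_
  rw [Fintype.card_piFinset]
  simp only [Finset.card_range, Finset.prod_const, Finset.card_univ, AlgHom.card]
  exact le_rfl

theorem ncard_conjBox_le_maxBoxCard {B : ℝ} {k : (K →ₐ[ℚ] ℂ) → ℕ} (hk : k ∈ dyadicExponents K B) :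
    (conjBox K fun σ => 2 ^ k σ).ncard ≤ maxBoxCard K B :=
  Finset.le_sup (f := fun k : (K →ₐ[ℚ] ℂ) → ℕ => (conjBox K fun σ => 2 ^ k σ).ncard) hk

theorem boundedGenerators_finite (B : ℝ) : (boundedGenerators K B).Finite := by
  classical
  refine (conjBox_finite (K := K) fun _ => B).subset ?_
  rintro b ⟨h1, -, h3⟩
  refine ⟨h1, fun σ => le_trans ?_ h3⟩
  rw [← Finset.mul_prod_erase _ _ (Finset.mem_univ σ)]
  exact (le_max_right _ _).trans (le_mul_of_one_le_right (by positivity)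
      (Finset.one_le_prod fun τ _ => le_max_left _ _))

/-- Per embedding, the binomial bound on coefficients costs 2^m and rounding up to a power of 2
costs another 2, whence the factor in `hB`. -/
theorem exists_dyadicExponents_coeff_mem {α : ℂ} (hα : IsIntegral ℤ α) (hK : K ≤ ℚ⟮α⟯) {m : ℕ}
    (hm : (minpoly K α).natDegree = m) {M B : ℝ}
    (hM : ((minpoly ℚ α).map (algebraMap ℚ ℂ)).mahlerMeasure ≤ M)
    (hB : 2 ^ Module.finrank ℚ K * (2 ^ m) ^ Module.finrank ℚ K * M ≤ B) :
    ∃ k ∈ dyadicExponents K B, ∀ i, (minpoly K α).coeff i ∈ conjBox K fun σ => 2 ^ k σ := by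
  have hαQ : IsIntegral ℚ α := hα.tower_top
  set μ : (K →ₐ[ℚ] ℂ) → ℝ := fun σ => ((minpoly K α).map (σ : K →+* ℂ)).mahlerMeasure with hμ
  have hμ1 : ∀ σ, 1 ≤ μ σ := fun σ =>
    one_le_mahlerMeasure_of_one_le_norm_leadingCoeff (by
      rw [((minpoly.monic hαQ.tower_top).map _).leadingCoeff, norm_one])
  have hex : ∀ σ, ∃ k : ℕ, 2 ^ m * μ σ ≤ 2 ^ k ∧ (2 : ℝ) ^ k ≤ 2 * (2 ^ m * μ σ) := fun σ => by
    have h1 : 1 ≤ 2 ^ m * μ σ := by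
      have := one_le_pow₀ (one_le_two : (1 : ℝ) ≤ 2) (n := m)
      nlinarith [hμ1 σ]
    obtain ⟨k, hk1, hk2⟩ := exists_nat_pow_near h1 (one_lt_two : (1 : ℝ) < 2)
    exact ⟨k + 1, hk2.le, by rw [pow_succ]; linarith⟩
  choose k hk1 hk2 using hex
  refine ⟨k, mem_dyadicExponents.2 ?_, fun i => ⟨isIntegral_coeff_minpoly K hα i, fun σ => ?_⟩⟩
  · calc ∏ σ, (2 : ℝ) ^ k σ ≤ ∏ σ, 2 * (2 ^ m * μ σ) :=
          Finset.prod_le_prod (fun _ _ => by positivity) fun σ _ => hk2 σ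
      _ = 2 ^ Module.finrank ℚ K * ((2 ^ m) ^ Module.finrank ℚ K * ∏ σ, μ σ) := by
          rw [Finset.prod_mul_distrib, Finset.prod_mul_distrib, Finset.prod_const,
            Finset.prod_const, Finset.card_univ, AlgHom.card]
      _ ≤ 2 ^ Module.finrank ℚ K * ((2 ^ m) ^ Module.finrank ℚ K * M) := by
          gcongr
          exact (prod_mahlerMeasure_map_minpoly_le hαQ hK).trans hM
      _ ≤ B := by rwa [← mul_assoc]
  · refine le_trans ?_ (hk1 σ)
    have h1 := norm_coeff_le_choose_mul_mahlerMeasure i ((minpoly K α).map (σ : K →+* ℂ))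
    rw [coeff_map, natDegree_map, hm] at h1
    refine h1.trans ?_
    have h2 : ((m.choose i : ℕ) : ℝ) ≤ 2 ^ m := by exact_mod_cast Nat.choose_le_two_pow m i
    exact mul_le_mul_of_nonneg_right h2 (mahlerMeasure_nonneg _)

/-- The coefficients over `K` of a factor determine the polynomial, lie in a dyadic box, and
one of them generates `K`. -/
theorem exists_coefficients_over_subfield {d m : ℕ} (hd : Module.finrank ℚ K = d) (hd1 : 1 < d)
    (hm0 : 0 < m) (hprim : ∀ b ∈ K, b ∉ (⊥ : IntermediateField ℚ ℂ) → ℚ⟮b⟯ = K)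
    {A : Finset (Fin (d * m) → ℤ)} {M B : ℝ} (hB : 2 ^ d * (2 ^ m) ^ d * M ≤ B)
    (hA : ∀ a ∈ A, ∃ α : ℂ, minpoly ℚ α = (monicOfCoeffs a).map (Int.castRingHom ℚ) ∧
      K ≤ ℚ⟮α⟯ ∧ ((monicOfCoeffs a).map (Int.castRingHom ℂ)).mahlerMeasure ≤ M) :
    ∃ c : (Fin (d * m) → ℤ) → Fin m → K, Set.InjOn c A ∧ ∀ a ∈ A,
      ∃ k ∈ dyadicExponents K B, (∀ i, c a i ∈ conjBox K fun σ => 2 ^ k σ) ∧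
        ∃ i, c a i ∈ boundedGenerators K B := by
  choose! α hα hKα hM using hA
  have hint : ∀ a ∈ A, IsIntegral ℤ (α a) := fun a ha => by
    refine ⟨monicOfCoeffs a, monicOfCoeffs_monic a, ?_⟩
    have h1 := minpoly.aeval ℚ (α a)
    rw [hα a ha, aeval_def, eval₂_map] at h1
    rwa [show (algebraMap ℚ ℂ).comp (Int.castRingHom ℚ) = algebraMap ℤ ℂ from
      Subsingleton.elim _ _] at h1
  have hintQ : ∀ a ∈ A, IsIntegral ℚ (α a) := fun a ha => (hint a ha).tower_top
  have hdegQ : ∀ a ∈ A, (minpoly ℚ (α a)).natDegree = d * m := fun a ha => by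
    rw [hα a ha, natDegree_map_eq_of_injective Int.cast_injective, natDegree_monicOfCoeffs]
  have hdeg : ∀ a ∈ A, (minpoly K (α a)).natDegree = m := fun a ha => by
    have h1 := finrank_mul_natDegree_minpoly (hintQ a ha) (hKα a ha)
    rw [hdegQ a ha] at h1
    exact Nat.eq_of_mul_eq_mul_left (by omega : 0 < d) (hd ▸ h1)
  refine ⟨fun a i => (minpoly K (α a)).coeff i, ?_, ?_⟩
  · intro a ha a' ha' h
    have hpoly : minpoly K (α a) = minpoly K (α a') := by
      ext1 i
      rcases lt_trichotomy i m with hi | hi | hi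
      · exact congrFun h ⟨i, hi⟩
      · have h1 := (minpoly.monic ((hintQ a ha).tower_top : IsIntegral K (α a))).coeff_natDegree
        have h2 := (minpoly.monic ((hintQ a' ha').tower_top : IsIntegral K (α a'))).coeff_natDegree
        rw [hdeg a ha, ← hi] at h1
        rw [hdeg a' ha', ← hi] at h2
        rw [h1, h2]
      · rw [coeff_eq_zero_of_natDegree_lt (by rwa [hdeg a ha]),
          coeff_eq_zero_of_natDegree_lt (by rwa [hdeg a' ha'])]
    have h1 := minpoly_rat_eq_of_minpoly_eq (hintQ a ha) hpoly
    rw [hα a ha, hα a' ha'] at h1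
    have h2 := map_injective _ Int.cast_injective h1
    funext j
    rw [← coeff_monicOfCoeffs a, ← coeff_monicOfCoeffs a', h2]
  · intro a ha
    have hMa : ((minpoly ℚ (α a)).map (algebraMap ℚ ℂ)).mahlerMeasure ≤ M := by
      rw [hα a ha, Polynomial.map_map]
      rw [show (algebraMap ℚ ℂ).comp (Int.castRingHom ℚ) = Int.castRingHom ℂ from
        Subsingleton.elim _ _]
      exact hM a ha
    obtain ⟨k, hk, hmem⟩ := exists_dyadicExponents_coeff_mem (B := B) (hint a ha) (hKα a ha) (hdeg a ha)
      hMa (by rwa [hd])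
    refine ⟨k, hk, fun i => hmem i, ?_⟩
    obtain ⟨i, hi, hbot⟩ := exists_coeff_minpoly_notMem_bot (K := K) (hintQ a ha) (by
      rw [hdeg a ha, hdegQ a ha]; nlinarith)
    rw [hdeg a ha] at hi
    refine ⟨⟨i, hi⟩, (hmem i).1, ?_, ?_⟩
    · exact adjoin_rat_eq_top_of_adjoin_coe_eq (hprim _ ((minpoly K (α a)).coeff i).2 hbot)
    · refine le_trans ?_ (mem_dyadicExponents.1 hk)
      refine Finset.prod_le_prod (fun _ _ => by positivity) fun σ _ => ?_
      exact max_le (one_le_pow₀ one_le_two) ((hmem i).2 σ)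

theorem card_le_of_common_subfield {d m : ℕ} (hd : Module.finrank ℚ K = d) (hd1 : 1 < d)
    (hm0 : 0 < m) (hprim : ∀ b ∈ K, b ∉ (⊥ : IntermediateField ℚ ℂ) → ℚ⟮b⟯ = K)
    {A : Finset (Fin (d * m) → ℤ)} {M B : ℝ} (hB : 2 ^ d * (2 ^ m) ^ d * M ≤ B)
    (hA : ∀ a ∈ A, ∃ α : ℂ, minpoly ℚ α = (monicOfCoeffs a).map (Int.castRingHom ℚ) ∧
      K ≤ ℚ⟮α⟯ ∧ ((monicOfCoeffs a).map (Int.castRingHom ℂ)).mahlerMeasure ≤ M) :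
    A.card ≤ (Nat.log 2 ⌊B⌋₊ + 1) ^ d * maxBoxCard K B ^ m ∧
    A.card ≤ (Nat.log 2 ⌊B⌋₊ + 1) ^ d *
      (m * ((boundedGenerators K B).ncard * maxBoxCard K B ^ (m - 1))) := by
  classical
  obtain ⟨c, hc, hbox⟩ := exists_coefficients_over_subfield hd hd1 hm0 hprim hB hA
  have hexp : (dyadicExponents K B).card ≤ (Nat.log 2 ⌊B⌋₊ + 1) ^ d :=
    hd ▸ card_dyadicExponents_le B
  set S : ((K →ₐ[ℚ] ℂ) → ℕ) → Finset K := fun k => (conjBox_finite fun σ => 2 ^ k σ).toFinset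
    with hS
  have hScard : ∀ k ∈ dyadicExponents K B, (S k).card ≤ maxBoxCard K B := fun k hk => by
    rw [hS, ← Set.ncard_eq_toFinset_card _ (conjBox_finite fun σ => 2 ^ k σ)]
    exact ncard_conjBox_le_maxBoxCard hk
  set Γ : Finset K := (boundedGenerators_finite (K := K) B).toFinset with hΓ
  have hΓcard : Γ.card = (boundedGenerators K B).ncard := (Set.ncard_eq_toFinset_card _ _).symm
  constructor
  · refine (card_le_of_forall_exists_box hc (labels := dyadicExponents K B)
      (S := fun k _ => S k) (N := maxBoxCard K B ^ m) ?_ ?_).trans (Nat.mul_le_mul_right _ hexp)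
    · intro a ha
      obtain ⟨k, hk, h1, -⟩ := hbox a ha
      exact ⟨k, hk, fun i => (Set.Finite.mem_toFinset _).2 (h1 i)⟩
    · intro k hk
      rw [Finset.prod_const, Finset.card_univ, Fintype.card_fin]
      exact Nat.pow_le_pow_left (hScard k hk) m
  -- The label also records which coefficient is a generator; this costs the factor `m`.
  · refine (card_le_of_forall_exists_box hc
      (labels := dyadicExponents K B ×ˢ (Finset.univ : Finset (Fin m)))
      (S := fun t i => if i = t.2 then Γ else S t.1)
      (N := (boundedGenerators K B).ncard * maxBoxCard K B ^ (m - 1)) ?_ ?_).trans ?_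
    · intro a ha
      obtain ⟨k, hk, h1, j, hj⟩ := hbox a ha
      refine ⟨(k, j), Finset.mem_product.2 ⟨hk, Finset.mem_univ _⟩, fun i => ?_⟩
      dsimp only
      split_ifs with h
      · rw [h]; exact (Set.Finite.mem_toFinset _).2 hj
      · exact (Set.Finite.mem_toFinset _).2 (h1 i)
    · rintro ⟨k, j⟩ hk
      have hk' := (Finset.mem_product.1 hk).1
      rw [← Finset.mul_prod_erase _ _ (Finset.mem_univ j)]
      dsimp only
      rw [if_pos rfl, hΓcard]
      refine Nat.mul_le_mul_left _ ?_
      rw [Finset.prod_congr rfl (g := fun _ => (S k).card), Finset.prod_const,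
        Finset.card_erase_of_mem (Finset.mem_univ _), Finset.card_univ, Fintype.card_fin]
      · exact Nat.pow_le_pow_left (hScard k hk') _
      · intro i hi
        rw [if_neg (Finset.ne_of_mem_erase hi)]
    · rw [Finset.card_product, Finset.card_univ, Fintype.card_fin, mul_assoc]
      exact Nat.mul_le_mul_right _ hexp

end FixedSubfield

/-! ### Summing over subfields -/

section Summation

open Polynomial IntermediateField

/-- The first two exponents come from the two ends of the range of N for fields with many integers
in a box, the third from the other fields. For d = 2 the second equals the middle entry of ν; for d
≥ 3 the last entry dominates it. -/
theorem le_nuExponent {d m : ℕ} (hd : 1 < d) :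
    (m : ℝ) ≤ nuExponent d m ∧ (1 - 1 / (d : ℝ)) * m + 2 ≤ nuExponent d m ∧
      (d : ℝ) + (1 - 1 / (d : ℝ)) * ((m : ℝ) - 1) ≤ nuExponent d m := by
  have hd0 : (0 : ℝ) < d := by exact_mod_cast (by omega : 0 < d)
  have hinv : 0 < 1 / (d : ℝ) := by positivity
  refine ⟨?_, ?_, (le_max_right _ _).trans (le_max_right _ _)⟩
  · exact le_trans (by linarith) (le_max_left _ _)
  · rcases Nat.lt_or_ge d 3 with h | h
    · obtain rfl : d = 2 := by omega
      refine le_trans (le_of_eq ?_) ((le_max_left _ _).trans (le_max_right _ _))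
      push_cast; ring
    · refine le_trans ?_ ((le_max_right _ _).trans (le_max_right _ _))
      have : (3 : ℝ) ≤ d := by exact_mod_cast h
      nlinarith

/-- The left side is a power of B times y^(m-2d), monotone in y: for m ≥ 2d the upper end of the
range decides, otherwise the lower end. -/
theorem pow_mul_div_pow_le {d m : ℕ} (hd : 0 < d) {B y c ν : ℝ} (hB : 1 ≤ B) (hc : 1 ≤ c)
    (hy : B ^ (1 - 1 / (d : ℝ)) ≤ y) (hyc : y ≤ c * B) (hν : (m : ℝ) ≤ ν)
    (hν' : (1 - 1 / (d : ℝ)) * m + 2 ≤ ν) : y ^ m * (B / y) ^ (2 * d) ≤ c ^ m * B ^ ν := by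
  have hB0 : 0 < B := by linarith
  have hy0 : 0 < y := lt_of_lt_of_le (by positivity) hy
  rcases le_total (2 * d) m with h | h
  · obtain ⟨k, rfl⟩ := Nat.exists_eq_add_of_le h
    calc y ^ (2 * d + k) * (B / y) ^ (2 * d) = y ^ k * B ^ (2 * d) := by
          rw [pow_add, div_pow]; field_simp
      _ ≤ (c * B) ^ k * B ^ (2 * d) := by gcongr
      _ = c ^ k * B ^ (2 * d + k) := by rw [mul_pow, pow_add]; ring
      _ ≤ c ^ (2 * d + k) * B ^ ν := by
          refine mul_le_mul (pow_le_pow_right₀ hc (by omega)) ?_ (by positivity) (by positivity)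
          rw [← Real.rpow_natCast]
          exact Real.rpow_le_rpow_of_exponent_le hB hν
  · obtain ⟨k, hk⟩ := Nat.exists_eq_add_of_le h
    have hd0 : (d : ℝ) ≠ 0 := by exact_mod_cast hd.ne'
    have hkR : (2 * d : ℝ) = m + k := by exact_mod_cast hk
    calc y ^ m * (B / y) ^ (2 * d) = B ^ (2 * d) / y ^ k := by
          rw [hk, div_pow, pow_add y]; field_simp
      _ ≤ B ^ (2 * d) / (B ^ (1 - 1 / (d : ℝ))) ^ k := by gcongr
      _ = B ^ ((1 - 1 / (d : ℝ)) * m + 2) := by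
          rw [← Real.rpow_natCast, ← Real.rpow_natCast (B ^ _), ← Real.rpow_mul hB0.le,
            ← Real.rpow_sub hB0]
          congr 1
          push_cast
          have : (k : ℝ) = 2 * d - m := by linarith
          rw [this]; field_simp; ring
      _ ≤ 1 * B ^ ν := by
          rw [one_mul]; exact Real.rpow_le_rpow_of_exponent_le hB hν'
      _ ≤ c ^ m * B ^ ν := by gcongr; exact one_le_pow₀ hc

theorem exists_natLog_le_rpow {c δ : ℝ} (hc : 1 ≤ c) (hδ : 0 < δ) :
    ∃ C : ℝ, 1 ≤ C ∧ ∀ B : ℝ, 1 ≤ B → (Nat.log 2 ⌊c * B⌋₊ + 1 : ℝ) ≤ C * B ^ δ := by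
  refine ⟨2 * c ^ δ / δ + 1, by
    have : 0 ≤ 2 * c ^ δ / δ := by positivity
    linarith, fun B hB => ?_⟩
  set t := Nat.log 2 ⌊c * B⌋₊ with ht
  have hcB : 1 ≤ c * B := one_le_mul_of_one_le_of_one_le hc hB
  have h0 : ⌊c * B⌋₊ ≠ 0 := (Nat.floor_pos.2 hcB).ne'
  have h1 : (2 : ℝ) ^ t ≤ c * B := by
    have h := Nat.pow_log_le_self 2 h0
    calc (2 : ℝ) ^ t = ((2 ^ t : ℕ) : ℝ) := by push_cast; rfl
      _ ≤ (⌊c * B⌋₊ : ℝ) := by exact_mod_cast h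
      _ ≤ c * B := Nat.floor_le (by linarith)
  have h2 : t * Real.log 2 ≤ (c * B) ^ δ / δ := by
    rw [← Real.log_pow]
    exact (Real.log_le_log (by positivity) h1).trans (Real.log_le_rpow_div (by linarith) hδ)
  have h3 : (t : ℝ) * (1 / 2) ≤ t * Real.log 2 := by
    have := Real.log_two_gt_d9
    gcongr
    linarith
  rw [Real.mul_rpow (by linarith) (by linarith)] at h2
  have h4 : 1 ≤ B ^ δ := Real.one_le_rpow hB hδ.le
  have h5 : (t : ℝ) ≤ 2 * c ^ δ / δ * B ^ δ := by
    have : 2 * c ^ δ / δ * B ^ δ = 2 * (c ^ δ * B ^ δ / δ) := by ring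
    linarith
  linarith

/-- Sums over a family of number fields with few small generators. -/
theorem sum_pow_le_of_small_generators {d m : ℕ} (hd : 1 < d) {B : ℝ} (hB : 1 ≤ B)
    {𝒦 : Finset (IntermediateField ℚ ℂ)} {N : IntermediateField ℚ ℂ → ℕ}
    (h : ∀ K ∈ 𝒦, 2 * 24 ^ d * B ^ (1 - 1 / (d : ℝ)) < N K ∧ (N K : ℝ) ≤ 8 * 24 ^ d * B ∧
      ∃ β ∈ boundedAlgebraicIntegers d (16 * (2 * 24 ^ d * B / N K) ^ 2), ℚ⟮β⟯ = K) :
    ∑ K ∈ 𝒦, (N K : ℝ) ^ m ≤ (Nat.log 2 ⌊8 * 24 ^ d * B⌋₊ + 1) *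
      (2 ^ m * (d * (3 * 2 ^ d * 16 * (2 * 24 ^ d) ^ 2) ^ d) * (8 * 24 ^ d) ^ m *
        B ^ nuExponent d m) := by
  classical
  set c : ℝ := 8 * 24 ^ d with hc
  have hB0 : 0 < B := by linarith
  have hNpos : ∀ K ∈ 𝒦, (0 : ℝ) < N K := fun K hK =>
    lt_of_le_of_lt (by positivity) (h K hK).1
  have hmaps : ∀ K ∈ 𝒦, Nat.log 2 (N K) ∈ Finset.range (Nat.log 2 ⌊c * B⌋₊ + 1) := fun K hK =>
    Finset.mem_range.2 (Nat.lt_succ_of_le (Nat.log_mono_right (Nat.le_floor (h K hK).2.1)))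
  -- Fields are grouped by the dyadic size of `N K`; the number of groups is the logarithmic factor.
  rw [← Finset.sum_fiberwise_of_maps_to hmaps]
  have hlen : ((Nat.log 2 ⌊c * B⌋₊ : ℝ) + 1) =
      ((Finset.range (Nat.log 2 ⌊c * B⌋₊ + 1)).card : ℝ) := by
    rw [Finset.card_range]; push_cast; rfl
  rw [hlen, ← nsmul_eq_mul]
  refine Finset.sum_le_card_nsmul _ _ _ fun t _ => ?_
  set 𝒦t := 𝒦.filter fun K => Nat.log 2 (N K) = t with h𝒦t
  rcases 𝒦t.eq_empty_or_nonempty with hemp | ⟨K₀, hK₀⟩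
  · rw [hemp, Finset.sum_empty]; positivity
  set y : ℝ := 2 ^ t with hy
  have hy0 : 0 < y := by positivity
  have hlow : ∀ K ∈ 𝒦t, y ≤ N K := fun K hK => by
    obtain ⟨h1, h2⟩ := Finset.mem_filter.1 hK
    have : N K ≠ 0 := by
      have := hNpos K h1
      rintro h0; rw [h0] at this; simp at this
    have h3 := Nat.pow_log_le_self 2 this
    rw [h2] at h3
    rw [hy]; exact_mod_cast h3
  have hupp : ∀ K ∈ 𝒦t, (N K : ℝ) ≤ 2 * y := fun K hK => by
    obtain ⟨h1, h2⟩ := Finset.mem_filter.1 hK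
    have h3 := Nat.lt_pow_succ_log_self one_lt_two (N K)
    rw [h2, pow_succ] at h3
    rw [hy, mul_comm]; exact_mod_cast h3.le
  have hyB : y ≤ c * B := (hlow K₀ hK₀).trans (h K₀ (Finset.mem_filter.1 hK₀).1).2.1
  have hyB' : B ^ (1 - 1 / (d : ℝ)) ≤ y := by
    have h1 := (h K₀ (Finset.mem_filter.1 hK₀).1).1.le.trans (hupp K₀ hK₀)
    have h2 : (1 : ℝ) ≤ 24 ^ d := one_le_pow₀ (by norm_num)
    have h3 : 0 ≤ B ^ (1 - 1 / (d : ℝ)) := by positivity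
    nlinarith
  set H : ℝ := 16 * (2 * 24 ^ d * B / y) ^ 2 with hH
  have hH1 : 1 ≤ H := by
    have h1 : 1 / 4 ≤ 2 * 24 ^ d * B / y := by
      rw [le_div_iff₀ hy0]; linarith
    rw [hH]; nlinarith
  obtain ⟨hfin, hcard⟩ := boundedAlgebraicIntegers_finite_card d H hH1
  have hKcard : (𝒦t.card : ℝ) ≤ d * (3 * 2 ^ d * H) ^ d := by
    refine le_trans ?_ hcard
    rw [Set.ncard_eq_toFinset_card _ hfin]
    -- As `N K` is at least `y` throughout the group, all the small generators have Mahler measure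
    -- at most `H`.
    have hsub : 𝒦t ⊆ hfin.toFinset.image fun β => ℚ⟮β⟯ := by
      intro K hK
      obtain ⟨-, -, β, hβ, rfl⟩ := h K (Finset.mem_filter.1 hK).1
      refine Finset.mem_image.2 ⟨β, hfin.mem_toFinset.2 ⟨hβ.1, hβ.2.1, hβ.2.2.trans ?_⟩, rfl⟩
      have := hlow _ hK
      rw [hH]; gcongr
    exact_mod_cast (Finset.card_le_card hsub).trans Finset.card_image_le
  calc ∑ K ∈ 𝒦t, (N K : ℝ) ^ m ≤ 𝒦t.card • (2 * y) ^ m := by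
        refine Finset.sum_le_card_nsmul _ _ _ fun K hK => ?_
        have := hupp K hK
        gcongr
    _ ≤ (d * (3 * 2 ^ d * H) ^ d) * (2 * y) ^ m := by
        rw [nsmul_eq_mul]; gcongr
    _ = 2 ^ m * (d * (3 * 2 ^ d * 16 * (2 * 24 ^ d) ^ 2) ^ d) * (y ^ m * (B / y) ^ (2 * d)) := by
        have : 3 * 2 ^ d * H = (3 * 2 ^ d * 16 * (2 * 24 ^ d) ^ 2) * (B / y) ^ 2 := by
          rw [hH]; ring
        rw [this, mul_pow _ ((B / y) ^ 2), ← pow_mul (B / y), mul_pow 2 y]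
        ring
    _ ≤ 2 ^ m * (d * (3 * 2 ^ d * 16 * (2 * 24 ^ d) ^ 2) ^ d) *
          (c ^ m * B ^ nuExponent d m) := by
        refine mul_le_mul_of_nonneg_left ?_ (by positivity)
        obtain ⟨hν1, hν2, -⟩ := le_nuExponent (m := m) hd
        refine pow_mul_div_pow_le (by omega) hB ?_ hyB' hyB hν1 hν2
        have : (1 : ℝ) ≤ 24 ^ d := one_le_pow₀ (by norm_num)
        linarith
    _ = _ := by ring

/-- A number generates only one field, so the sets for different `K` are disjoint. -/
theorem sum_card_generators_le {d : ℕ} {B : ℝ} (hB : 1 ≤ B)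
    {𝒦 : Finset (IntermediateField ℚ ℂ)} {S : IntermediateField ℚ ℂ → Finset ℂ}
    (h : ∀ K ∈ 𝒦, ∀ β ∈ S K, β ∈ boundedAlgebraicIntegers d B ∧ ℚ⟮β⟯ = K) :
    ∑ K ∈ 𝒦, ((S K).card : ℝ) ≤ d * (3 * 2 ^ d * B) ^ d := by
  classical
  obtain ⟨hfin, hcard⟩ := boundedAlgebraicIntegers_finite_card d B hB
  refine le_trans ?_ hcard
  rw [Set.ncard_eq_toFinset_card _ hfin, ← Nat.cast_sum, ← Finset.card_biUnion]
  · refine Nat.cast_le.2 (Finset.card_le_card fun β hβ => ?_)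
    obtain ⟨K, hK, hβK⟩ := Finset.mem_biUnion.1 hβ
    exact hfin.mem_toFinset.2 (h K hK β hβK).1
  · intro K hK K' hK' hne
    refine Finset.disjoint_left.2 fun β hβ hβ' => hne ?_
    rw [← (h K hK β hβ).2, (h K' hK' β hβ').2]

/-- The contribution of one subfield, with its generators regarded as complex numbers. -/
theorem exists_card_bounds_of_common_subfield {K : IntermediateField ℚ ℂ} {d m : ℕ}
    (hd : Module.finrank ℚ K = d) (hd1 : 1 < d)
    (hm0 : 0 < m) (hprim : ∀ b ∈ K, b ∉ (⊥ : IntermediateField ℚ ℂ) → ℚ⟮b⟯ = K)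
    {A : Finset (Fin (d * m) → ℤ)} {M B : ℝ} (hB1 : 1 ≤ B) (hB : 2 ^ d * (2 ^ m) ^ d * M ≤ B)
    (hA : ∀ a ∈ A, ∃ α : ℂ, minpoly ℚ α = (monicOfCoeffs a).map (Int.castRingHom ℚ) ∧
      K ≤ ℚ⟮α⟯ ∧ ((monicOfCoeffs a).map (Int.castRingHom ℂ)).mahlerMeasure ≤ M) :
    ∃ (N : ℕ) (S : Finset ℂ), A.card ≤ (Nat.log 2 ⌊B⌋₊ + 1) ^ d * N ^ m ∧
      A.card ≤ (Nat.log 2 ⌊B⌋₊ + 1) ^ d * (m * (S.card * N ^ (m - 1))) ∧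
      (∀ β ∈ S, β ∈ boundedAlgebraicIntegers d B ∧ ℚ⟮β⟯ = K) ∧
      (2 * 24 ^ d * B ^ (1 - 1 / (d : ℝ)) < N → (N : ℝ) ≤ 8 * 24 ^ d * B ∧
        ∃ β ∈ boundedAlgebraicIntegers d (16 * (2 * 24 ^ d * B / N) ^ 2), ℚ⟮β⟯ = K) := by
  classical
  have : FiniteDimensional ℚ K := Module.finite_of_finrank_pos (by omega)
  obtain ⟨h1, h2⟩ := card_le_of_common_subfield hd hd1 hm0 hprim hB hA
  -- As `d > 1`, a generator is not rational, and `hprim` applies.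
  have hgen : ∀ b : K, ℚ⟮b⟯ = ⊤ → ℚ⟮(b : ℂ)⟯ = K := fun b hb => by
    refine hprim b b.2 fun hbot => ?_
    obtain ⟨q, hq⟩ := IntermediateField.mem_bot.1 hbot
    have hb' : b ∈ (⊥ : IntermediateField ℚ K) :=
      IntermediateField.mem_bot.2 ⟨q, Subtype.ext hq⟩
    rw [adjoin_simple_eq_bot_iff.2 hb'] at hb
    have := IntermediateField.finrank_bot (F := ℚ) (E := K)
    rw [hb, IntermediateField.finrank_top', hd] at this
    omega
  refine ⟨maxBoxCard K B, ((boundedGenerators_finite (K := K) B).toFinset).image fun b : K => (b : ℂ),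
    h1, ?_, ?_, ?_⟩
  · rwa [Finset.card_image_of_injective _ Subtype.val_injective,
      ← Set.ncard_eq_toFinset_card _ (boundedGenerators_finite B)]
  · intro β hβ
    obtain ⟨b, hb, rfl⟩ := Finset.mem_image.1 hβ
    obtain ⟨hb1, hb2, hb3⟩ := (Set.Finite.mem_toFinset _).1 hb
    exact ⟨hd ▸ coe_mem_boundedAlgebraicIntegers hb1 hb2 hb3, hgen b hb2⟩
  · intro hN
    have hne : (dyadicExponents K B).Nonempty :=
      ⟨fun _ => 0, mem_dyadicExponents.2 (by simpa using hB1)⟩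
    obtain ⟨k, hk, hkN⟩ := Finset.exists_mem_eq_sup (dyadicExponents K B) hne
      fun k => (conjBox K fun σ => 2 ^ k σ).ncard
    have hkN' : maxBoxCard K B = (conjBox K fun σ => 2 ^ k σ).ncard := hkN
    rw [hkN'] at hN ⊢
    obtain ⟨h3, b, hb1, hb2, hb3⟩ := exists_small_generator_of_lt_ncard
      (fun σ => one_le_pow₀ one_le_two) (mem_dyadicExponents.1 hk) (by rwa [hd])
    have h4 := coe_mem_boundedAlgebraicIntegers hb1 hb2 hb3
    rw [hd] at h3 h4
    exact ⟨h3, b, h4, hgen b hb2⟩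

end Summation

/-! ### The count in the coefficient box -/

section Counting

open Polynomial IntermediateField

theorem abs_le_of_mem_coeffBox {n : ℕ} {L : ℝ} {a : Fin n → ℤ} (ha : a ∈ coeffBox n L)
    (i : Fin n) : |(a i : ℝ)| ≤ L := by
  have h := Finset.mem_Icc.1 (Fintype.mem_piFinset.1 ha i)
  exact abs_le.2 ⟨Int.ceil_le.1 h.1, Int.le_floor.1 h.2⟩

theorem mahlerMeasure_le_of_mem_coeffBox {n : ℕ} {L : ℝ} (hL : 1 ≤ L) {a : Fin n → ℤ}
    (ha : a ∈ coeffBox n L) :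
    ((monicOfCoeffs a).map (Int.castRingHom ℂ)).mahlerMeasure ≤ (n + 1) * L := by
  refine (mahlerMeasure_le_sum_norm_coeff _).trans ?_
  rw [sum_over_range _ fun _ => norm_zero, natDegree_map_eq_of_injective Int.cast_injective,
    natDegree_monicOfCoeffs]
  refine (Finset.sum_le_card_nsmul _ _ L fun i hi => ?_).trans (le_of_eq ?_)
  · have hnorm : ‖((monicOfCoeffs a).map (Int.castRingHom ℂ)).coeff i‖ =
        |((monicOfCoeffs a).coeff i : ℝ)| := by
      rw [coeff_map, eq_intCast, Complex.norm_intCast]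
    rw [hnorm]
    rcases Nat.lt_succ_iff_lt_or_eq.1 (Finset.mem_range.1 hi) with h | rfl
    · rw [show i = ((⟨i, h⟩ : Fin n) : ℕ) from rfl, coeff_monicOfCoeffs]
      exact abs_le_of_mem_coeffBox ha _
    · have h1 := (monicOfCoeffs_monic a).coeff_natDegree
      rw [natDegree_monicOfCoeffs] at h1
      rw [h1]; simpa using hL
  · rw [Finset.card_range, nsmul_eq_mul]; push_cast; rfl

theorem pow_le_card_coeffBox (n : ℕ) {L : ℝ} (hL : 1 ≤ L) :
    L ^ n ≤ ((coeffBox n L).card : ℝ) := by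
  rw [coeffBox, Fintype.card_piFinset]
  simp only [Int.card_Icc, Finset.prod_const, Finset.card_univ, Fintype.card_fin, Int.ceil_neg]
  push_cast
  gcongr
  have h1 : 0 ≤ ⌊L⌋ := Int.floor_nonneg.2 (by linarith)
  have h2 : (((⌊L⌋ + 1 - -⌊L⌋).toNat : ℕ) : ℝ) = ⌊L⌋ + 1 + ⌊L⌋ := by
    have : (((⌊L⌋ + 1 - -⌊L⌋).toNat : ℤ)) = ⌊L⌋ + 1 + ⌊L⌋ := by
      rw [Int.toNat_of_nonneg (by omega)]; ring
    exact_mod_cast this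
  rw [h2]
  have h3 := Int.lt_floor_add_one L
  have h4 : (0 : ℝ) ≤ ⌊L⌋ := by exact_mod_cast h1
  linarith

theorem exists_card_hasGaloisGroup_le {d m : ℕ} (hd : 1 < d) (hm : 0 < m) {ε : ℝ} (hε : 0 < ε) :
    ∃ C : ℝ, 0 < C ∧ ∀ G : Subgroup (Equiv.Perm (Fin (d * m))),
      IsTransitiveImprimitiveWithPrimitiveQuotient d G → ∀ L : ℝ, 1 ≤ L →
        ∀ A : Finset (Fin (d * m) → ℤ), A ⊆ coeffBox (d * m) L →
          (∀ a ∈ A, HasGaloisGroup (monicOfCoeffs a) G) →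
            (A.card : ℝ) ≤ C * L ^ (nuExponent d m + ε) := by
  classical
  have hd0 : (0 : ℝ) < d := by exact_mod_cast (by omega : 0 < d)
  have h24 : (1 : ℝ) ≤ 24 ^ d := one_le_pow₀ (by norm_num)
  set ν := nuExponent d m with hν
  set c₁ : ℝ := 2 ^ d * (2 ^ m) ^ d * ((d * m : ℕ) + 1) with hc₁
  have hc₁1 : 1 ≤ c₁ := by
    refine one_le_mul_of_one_le_of_one_le (one_le_mul_of_one_le_of_one_le ?_ ?_) ?_
    · exact one_le_pow₀ one_le_two
    · exact one_le_pow₀ (one_le_pow₀ one_le_two)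
    · have : (0 : ℝ) ≤ (d * m : ℕ) := Nat.cast_nonneg _
      linarith
  -- There are `d + 1` logarithms to absorb: `d` from the dyadic boxes, one from the grouping by `N
  -- K`.
  have hδ : 0 < ε / (d + 1) := by positivity
  obtain ⟨Cl, hCl1, hCl⟩ := exists_natLog_le_rpow (c := 8 * 24 ^ d) (by linarith) hδ
  set Q₁ : ℝ := m * ((2 * 24 ^ d) ^ (m - 1) * (d * (3 * 2 ^ d) ^ d)) with hQ₁
  set Q₂ : ℝ := 2 ^ m * (d * (3 * 2 ^ d * 16 * (2 * 24 ^ d) ^ 2) ^ d) * (8 * 24 ^ d) ^ m with hQ₂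
  refine ⟨Cl ^ (d + 1) * (Q₁ + Q₂) * c₁ ^ (ν + ε), by positivity, ?_⟩
  intro G hG L hL A hAbox hAG
  set B := c₁ * L with hBdef
  have hB1 : 1 ≤ B := one_le_mul_of_one_le_of_one_le hc₁1 hL
  have hB0 : 0 < B := by linarith
  have hBM : 2 ^ d * (2 ^ m) ^ d * (((d * m : ℕ) + 1) * L) ≤ B := by
    rw [hBdef, hc₁, mul_assoc (2 ^ d * (2 ^ m) ^ d : ℝ)]
  have hsub := fun a (ha : a ∈ A) => exists_primitive_subfield_of_hasGaloisGroup
    (Nat.mul_pos (by omega) hm) hd hG (hAG a ha)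
  choose! α κ hα hκd hκα hκprim using hsub
  set 𝒦 := A.image κ with h𝒦
  have hper : ∀ K ∈ 𝒦, ∃ (N : ℕ) (S : Finset ℂ),
      (A.filter fun a => κ a = K).card ≤ (Nat.log 2 ⌊B⌋₊ + 1) ^ d * N ^ m ∧
      (A.filter fun a => κ a = K).card ≤
        (Nat.log 2 ⌊B⌋₊ + 1) ^ d * (m * (S.card * N ^ (m - 1))) ∧
      (∀ β ∈ S, β ∈ boundedAlgebraicIntegers d B ∧ ℚ⟮β⟯ = K) ∧
      (2 * 24 ^ d * B ^ (1 - 1 / (d : ℝ)) < N → (N : ℝ) ≤ 8 * 24 ^ d * B ∧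
        ∃ β ∈ boundedAlgebraicIntegers d (16 * (2 * 24 ^ d * B / N) ^ 2), ℚ⟮β⟯ = K) := by
    intro K hK
    obtain ⟨a₀, ha₀, rfl⟩ := Finset.mem_image.1 hK
    refine exists_card_bounds_of_common_subfield (hκd a₀ ha₀) hd hm (hκprim a₀ ha₀) hB1 hBM ?_
    intro a ha
    obtain ⟨ha1, ha2⟩ := Finset.mem_filter.1 ha
    exact ⟨α a, hα a ha1, ha2 ▸ hκα a ha1, mahlerMeasure_le_of_mem_coeffBox hL (hAbox ha1)⟩
  choose! N S hN1 hN2 hS hsmall using hper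
  set F : IntermediateField ℚ ℂ → ℝ := fun K => ((A.filter fun a => κ a = K).card : ℝ)
  have hF : ∀ K, F K = ((A.filter fun a => κ a = K).card : ℝ) := fun _ => rfl
  have hAsum : (A.card : ℝ) = ∑ K ∈ 𝒦, F K := by
    rw [Finset.card_eq_sum_card_image κ A]; push_cast; rfl
  set ℓ : ℝ := Nat.log 2 ⌊8 * 24 ^ d * B⌋₊ + 1 with hℓ
  have hℓ0 : 0 ≤ ℓ := by positivity
  have hℓ1 : 1 ≤ ℓ := by
    have : (0 : ℝ) ≤ Nat.log 2 ⌊8 * 24 ^ d * B⌋₊ := Nat.cast_nonneg _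
    rw [hℓ]; linarith
  have hlog : (((Nat.log 2 ⌊B⌋₊ + 1 : ℕ) ^ d : ℕ) : ℝ) ≤ ℓ ^ d := by
    have h1 : Nat.log 2 ⌊B⌋₊ ≤ Nat.log 2 ⌊8 * 24 ^ d * B⌋₊ :=
      Nat.log_mono_right (Nat.floor_le_floor (le_mul_of_one_le_left hB0.le (by linarith)))
    push_cast
    rw [hℓ]
    gcongr
  -- The threshold above which the pigeonhole argument produces a small generator.
  set P : ℝ := 2 * 24 ^ d * B ^ (1 - 1 / (d : ℝ)) with hP
  obtain ⟨-, -, hν3⟩ := le_nuExponent (m := m) hd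
  have hone : ∑ K ∈ 𝒦 with (N K : ℝ) ≤ P, F K ≤ ℓ ^ d * (Q₁ * B ^ ν) := by
    calc ∑ K ∈ 𝒦 with (N K : ℝ) ≤ P, F K
        ≤ ∑ K ∈ 𝒦 with (N K : ℝ) ≤ P, ℓ ^ d * (m * P ^ (m - 1)) * ((S K).card : ℝ) := by
          refine Finset.sum_le_sum fun K hK => ?_
          obtain ⟨hK1, hK2⟩ := Finset.mem_filter.1 hK
          calc F K ≤ (((Nat.log 2 ⌊B⌋₊ + 1 : ℕ) ^ d : ℕ) : ℝ) *
                (m * ((S K).card * (N K : ℝ) ^ (m - 1))) := by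
                  rw [hF]; exact_mod_cast hN2 K hK1
            _ ≤ ℓ ^ d * (m * ((S K).card * P ^ (m - 1))) := by gcongr
            _ = _ := by ring
      _ = ℓ ^ d * (m * P ^ (m - 1)) * ∑ K ∈ 𝒦 with (N K : ℝ) ≤ P, ((S K).card : ℝ) := by
          rw [Finset.mul_sum]
      _ ≤ ℓ ^ d * (m * P ^ (m - 1)) * (d * (3 * 2 ^ d * B) ^ d) := by
          gcongr
          exact sum_card_generators_le hB1 fun K hK => hS K (Finset.mem_filter.1 hK).1
      _ = ℓ ^ d * (Q₁ * B ^ ((d : ℝ) + (1 - 1 / (d : ℝ)) * ((m : ℝ) - 1))) := by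
          have h1 : B ^ ((d : ℝ) + (1 - 1 / (d : ℝ)) * ((m : ℝ) - 1)) =
              (B ^ (1 - 1 / (d : ℝ))) ^ (m - 1) * B ^ d := by
            rw [add_comm, Real.rpow_add hB0, Real.rpow_mul hB0.le, Real.rpow_natCast,
              ← Nat.cast_pred hm, Real.rpow_natCast]
          rw [h1, hP, hQ₁, mul_pow, mul_pow (3 * 2 ^ d : ℝ)]
          ring
      _ ≤ ℓ ^ d * (Q₁ * B ^ ν) := by
          have h1 := Real.rpow_le_rpow_of_exponent_le hB1 hν3
          have h2 : 0 ≤ Q₁ := by positivity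
          gcongr
  have htwo : ∑ K ∈ 𝒦 with ¬ (N K : ℝ) ≤ P, F K ≤ ℓ ^ d * (ℓ * (Q₂ * B ^ ν)) := by
    calc ∑ K ∈ 𝒦 with ¬ (N K : ℝ) ≤ P, F K
        ≤ ∑ K ∈ 𝒦 with ¬ (N K : ℝ) ≤ P, ℓ ^ d * (N K : ℝ) ^ m := by
          refine Finset.sum_le_sum fun K hK => ?_
          obtain ⟨hK1, hK2⟩ := Finset.mem_filter.1 hK
          calc F K ≤ (((Nat.log 2 ⌊B⌋₊ + 1 : ℕ) ^ d : ℕ) : ℝ) * (N K : ℝ) ^ m := by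
                rw [hF]; exact_mod_cast hN1 K hK1
            _ ≤ _ := by gcongr
      _ = ℓ ^ d * ∑ K ∈ 𝒦 with ¬ (N K : ℝ) ≤ P, (N K : ℝ) ^ m := by rw [Finset.mul_sum]
      _ ≤ ℓ ^ d * (ℓ * (Q₂ * B ^ ν)) := by
          gcongr
          refine sum_pow_le_of_small_generators hd hB1 fun K hK => ?_
          obtain ⟨hK1, hK2⟩ := Finset.mem_filter.1 hK
          exact ⟨not_le.1 hK2, hsmall K hK1 (not_le.1 hK2)⟩
  have hlogB : ℓ ^ (d + 1) ≤ Cl ^ (d + 1) * B ^ ε := by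
    calc ℓ ^ (d + 1) ≤ (Cl * B ^ (ε / (d + 1))) ^ (d + 1) := by
          have := hCl B hB1
          gcongr
      _ = Cl ^ (d + 1) * B ^ ε := by
          rw [mul_pow, ← Real.rpow_natCast (B ^ _), ← Real.rpow_mul hB0.le]
          congr 2
          push_cast
          field_simp
  have hQ₁0 : 0 ≤ Q₁ := by positivity
  have hQ₂0 : 0 ≤ Q₂ := by positivity
  calc (A.card : ℝ) ≤ ℓ ^ d * (Q₁ * B ^ ν) + ℓ ^ d * (ℓ * (Q₂ * B ^ ν)) := by
        rw [hAsum, ← Finset.sum_filter_add_sum_filter_not 𝒦 fun K => (N K : ℝ) ≤ P]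
        exact add_le_add hone htwo
    _ ≤ ℓ ^ d * (ℓ * (Q₁ * B ^ ν)) + ℓ ^ d * (ℓ * (Q₂ * B ^ ν)) := by
        have h1 : 0 ≤ Q₁ * B ^ ν := by positivity
        have h2 : Q₁ * B ^ ν ≤ ℓ * (Q₁ * B ^ ν) := le_mul_of_one_le_left h1 hℓ1
        gcongr
    _ = ℓ ^ (d + 1) * ((Q₁ + Q₂) * B ^ ν) := by ring
    _ ≤ Cl ^ (d + 1) * B ^ ε * ((Q₁ + Q₂) * B ^ ν) := by gcongr
    _ = Cl ^ (d + 1) * (Q₁ + Q₂) * B ^ (ν + ε) := by rw [Real.rpow_add hB0]; ring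
    _ = _ := by rw [hBdef, Real.mul_rpow (by linarith) (by linarith)]; ring

end Counting

theorem proposition4p9 (n₁ n₂ : ℕ) (hn₁ : 1 < n₁) (hn₂ : 1 < n₂) (ε : ℝ) (hε : 0 < ε) :
    ∃ C : ℝ, 0 < C ∧
      ∀ G : Subgroup (Equiv.Perm (Fin (n₁ * n₂))),
        IsTransitiveImprimitiveWithPrimitiveQuotient n₁ G →
          ∀ L : ℝ, 1 ≤ L →
            boxProb (n₁ * n₂) L (fun f => HasGaloisGroup f G) ≤
              C * L ^ (-((n₁ * n₂ : ℕ) : ℝ) + nuExponent n₁ n₂ + ε) := by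
  classical
  obtain ⟨C, hC, h⟩ := exists_card_hasGaloisGroup_le hn₁ (by omega : 0 < n₂) hε
  refine ⟨C, hC, fun G hG L hL => ?_⟩
  have hL0 : 0 < L := by linarith
  have hcard := pow_le_card_coeffBox (n₁ * n₂) hL
  rw [boxProb, div_le_iff₀ (lt_of_lt_of_le (by positivity) hcard)]
  refine (h G hG L hL _ (Finset.filter_subset _ _) fun a ha => (Finset.mem_filter.1 ha).2).trans ?_
  calc C * L ^ (nuExponent n₁ n₂ + ε)
      = C * L ^ (-((n₁ * n₂ : ℕ) : ℝ) + nuExponent n₁ n₂ + ε) * L ^ (n₁ * n₂) := by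
        rw [← Real.rpow_natCast L, mul_assoc, ← Real.rpow_add hL0]
        congr 2
        ring
    _ ≤ _ := by gcongr
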